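/- **Setting.** Let $N\ge 1$, $\mathbb S=\{1,\dots,N\}$, $\bar{\mathbb S}=\{\bar 1,\dots,\bar N\}$, $\mathcal S=\mathbb S\cup\bar{\mathbb S}$. Let $t=(t_{ja})_{j\ge1,a\in\mathcal S}$ be formal variables, $R=\mathbb C[[t]]$ with the topology of coefficientwise convergence, and let $s=(s_a)_{a\in\mathcal S}\in\mathbb Z^{\mathcal S}$ range over the zero charge sector $\sum_a s_a=0$. Consider formal series $\sum_{j\in\mathbb Z}X_j(n)\Lambda^j$, $X_j:\mathbb Z\to M_N(R)$, with product $(X(n)\Lambda^i)(Y(n)\Lambda^j)=X(n)Y(n+i)\Lambda^{i+j}$, and let $\mathfrak g$ be any associative algebra of such series (a complex vector space of series, closed under the product, on which the sums defining the products converge unconditionally coefficientwise and the product is associative) containing $1,\Lambda^{\pm1}$, the operator $n$ of multiplication by $n$, and the matrix units $E_{kk}$. Let $G$ be the group of invertible elements of $\mathfrak g$, $G_-\subset G$ the group of elements which, together with their inverses, have the form $1+\sum_{j<0}X_j(n)\Lambda^j$, and $G_+\subset G$ the group of elements which, together with their inverses, have the form $\sum_{j\ge0}X_j(n)\Lambda^j$.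 Assume that $$W_0=\sum_kE_{kk}\Lambda^{s_k}e^{\sum_{j\ge1}t_{jk}\Lambda^j},\qquad \bar W_0=\sum_kE_{kk}\Lambda^{-s_{\bar k}}e^{\sum_{j\ge1}t_{j\bar k}\Lambda^{-j}}$$ lie in $G$, let $g\in G$ have coefficients in $M_N(\mathbb C)$ independent of $s$ and $t$, and for all $s$ let $S=1+\varphi_1(n)\Lambda^{-1}+\cdots\in G_-$ and $\bar S=\bar\varphi_0(n)+\bar\varphi_1(n)\Lambda+\cdots\in G_+$ solve $S\,W_0\,g=\bar S\,\bar W_0$. Put $W=SW_0$, $\bar W=\bar S\bar W_0$ and $$L=W\Lambda W^{-1},\ M=WnW^{-1},\ C_{kk}=WE_{kk}W^{-1},\qquad \bar L=\bar W\Lambda\bar W^{-1},\ \bar M=\bar Wn\bar W^{-1},\ \bar C_{kk}=\bar WE_{kk}\bar W^{-1}.$$ With $\chi=\{z^n I_N\}_{n\in\mathbb Z}$, $\psi=W\chi$, $\bar\psi=\bar W\chi$ (formal two-sided series in $z$), let $\Psi_k=\psi_{1k}$ and $\Psi_{\bar k}=\bar\psi_{1k}$. **Scalar operators.** Let $T_{(a,b)}$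 be the shift $s_a\mapsto s_a+1$, $s_b\mapsto s_b-1$ on functions of $s$. Fix $a_0\in\mathcal S\setminus\{1\}$ and $\bar a_0\in\mathcal S\setminus\{\bar1\}$, and put $\mathcal T_1=T_{(1,a_0)}$, $\mathcal T_a=T_{(a,1)}$ for $a\ne1$; $\bar{\mathcal T}_{\bar1}=T_{(\bar1,\bar a_0)}$, $\bar{\mathcal T}_a=T_{(a,\bar1)}$ for $a\neq\bar1$. For each $n$ let $$\mathscr K_1=1+\sum_{i\ge1}\varphi_{i,11}\mathcal T_1^{-i},\qquad \mathscr K_k=\sum_{i\ge0}\varphi_{i+1,1k}\mathcal T_k^{-i}\ (k\ne1),\qquad \mathscr K_{\bar k}=\sum_{i\ge0}\bar\varphi_{i,1k}\mathcal T_{\bar k}^{-i},$$ and assume that for all $s,n$ the leading coefficients $\varphi_{1,1k}$ ($k\ne1$) and $\bar\varphi_{0,1k}$ (all $k$) are invertible in $R$, so that $\mathscr K_a^{-1}$ exists as a series in nonpositive powers of $\mathcal T_a$. Put $\mathscr W_a=\mathscr K_a\exp(\sum_{j\ge1}t_{ja}\mathcal T_a^j)$, $$\mathscr L_a=\mathscr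 K_a\mathcal T_a\mathscr K_a^{-1},\qquad \mathscr M_a=n-\nu_a+\operatorname{sg}(a)\,\mathscr W_a s_a\mathscr W_a^{-1},$$ where $\operatorname{sg}=1$ on $\mathbb S$, $\operatorname{sg}=-1$ on $\bar{\mathbb S}$, $\nu_a=1$ if $a\in\mathbb S\setminus\{1\}$ and $\nu_a=0$ otherwise. The barred operators $\bar{\mathscr L}_a,\bar{\mathscr M}_a$ are defined by the same formulae with $\bar{\mathcal T}_a$ in place of $\mathcal T_a$. For $X=\sum_jc_j\mathcal T_a^j$ let $X_+=\sum_{j\ge0}c_j\mathcal T_a^j$ if $a=1$ and $X_+=\sum_{j>0}c_j\mathcal T_a^j$ if $a\ne1$. For $X=\sum_jc_j\bar{\mathcal T}_a^j$ let $X_+=\sum_{j\ge0}c_j\bar{\mathcal T}_a^j$ if $a=1$; $X_+=\sum_{j>0}c_j\bar{\mathcal T}_a^j$ if $a=\bar1$ and $\bar a_0=1$; and $X_+=\sum_{j>0}c_j(\bar{\mathcal T}_a^j-1)$ in all other cases. **Statement.** For each $a\in\mathcal S$ let $F_a(x,y)=\sum_{i\ge0,\,j\in\mathbb Z}F_{aij}x^iy^j$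 with $F_{aij}\in\mathbb C$, where the powers of $y$ are bounded above and the coefficient of each power of $y$ is a polynomial in $x$; operators are inserted in this order, $F(M,L)=\sum F_{ij}M^iL^j$. Let $s$ be in the zero charge sector. If the string equation $$E_{11}\sum_{k=1}^NF_k(M,L)C_{kk}=E_{11}\sum_{k=1}^NF_{\bar k}(\bar M,\bar L^{-1})\bar C_{kk}$$ holds at $s$, then at $s$, for all $a\in\mathcal S$ and all $n\in\mathbb Z$, $$F_a(\mathscr M_a,\mathscr L_a)(\Psi_a)=\Big(\sum_{a'\in\mathcal S}F_{a'}(\mathscr M_{a'},\mathscr L_{a'})_+\Big)(\Psi_a),\qquad F_a(\bar{\mathscr M}_a,\bar{\mathscr L}_a)(\Psi_a)=\Big(\sum_{a'\in\mathcal S}F_{a'}(\bar{\mathscr M}_{a'},\bar{\mathscr L}_{a'})_+\Big)(\Psi_a),$$ and the sums defining the series $F_a(\mathscr M_a,\mathscr L_a)$, $F_a(\bar{\mathscr M}_a,\bar{\mathscr L}_a)$ and the actions on $\Psi_a$ converge coefficientwise (as identities of formal Laurent series in $z$ with coefficients in $R$). -/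

import Mathlib

open scoped MvPowerSeries.WithPiTopology

noncomputable section

namespace Toda

/-! ## Formal series in a shift operator

`P` is an additive group of discrete variables and `v : P` a direction.  A `ShiftSeries P A` is a
two-sided formal series `X = ∑_{j ∈ ℤ} X_j(p) Θ^j` in the shift `(Θ f)(p) = f(p + v)`, with
coefficients `X_j : P → A`; `X j p` is the value at `p` of the coefficient of `Θ^j`.  Products and
actions are given by coefficientwise unconditionally convergent sums. -/

abbrev ShiftSeries (P A : Type*) := ℤ → P → A

section Series

variable {P A : Type*} [AddCommGroup P]

/-- The series `f(p) Θ^j`. -/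
def monomial [Zero A] (j : ℤ) (f : P → A) : ShiftSeries P A :=
  fun i p => if i = j then f p else 0

/-- The product determined by `(X(p) Θ^i) (Y(p) Θ^j) = X(p) Y(p + i v) Θ^(i+j)`. -/
def mul [Ring A] [TopologicalSpace A] (v : P) (X Y : ShiftSeries P A) : ShiftSeries P A :=
  fun j p => ∑' i : ℤ, X i p * Y (j - i) (p + i • v)

/-- The unit series. -/
def one [Ring A] : ShiftSeries P A := monomial 0 (fun _ => 1)

/-- Powers `X^m`. -/
def npow [Ring A] [TopologicalSpace A] (v : P) (X : ShiftSeries P A) : ℕ → ShiftSeries P A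
  | 0 => one
  | m + 1 => mul v (npow v X m) X

/-- Integer powers of a series `X` with inverse `X'`. -/
def zpow [Ring A] [TopologicalSpace A] (v : P) (X X' : ShiftSeries P A) (j : ℤ) :
    ShiftSeries P A :=
  if 0 ≤ j then npow v X j.toNat else npow v X' (-j).toNat

/-- The exponential `∑_m X^m / m!`. -/
def exp [Ring A] [TopologicalSpace A] [Module ℂ A] (v : P) (X : ShiftSeries P A) :
    ShiftSeries P A :=
  fun j p => ∑' m : ℕ, ((m.factorial : ℂ)⁻¹) • npow v X m j p

/-- The inverse of `X` among the series without positive powers of `Θ` (`0` if there is none). -/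
def lowerInv [Ring A] [TopologicalSpace A] (v : P) (X : ShiftSeries P A) : ShiftSeries P A :=
  open Classical in
  if h : ∃ Y : ShiftSeries P A, (∀ j, 0 < j → ∀ p, Y j p = 0) ∧ mul v X Y = one ∧ mul v Y X = one
  then h.choose else 0

/-- The terms `X_j(p) f(p + j v)` of `(X f)(p) = ∑_j X_j(p) f(p + j v)`.  The values of `f` are
formal two-sided Laurent series in `z`; `f p m` is the coefficient of `z^m` in `f p`. -/
def actTerm [Ring A] (v : P) (X : ShiftSeries P A) (f : P → ℤ → A) (p : P) (m : ℤ) : ℤ → A :=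
  fun j => X j p * f (p + j • v) m

/-- The action of `X` on functions with values in formal Laurent series in `z`. -/
def act [Ring A] [TopologicalSpace A] (v : P) (X : ShiftSeries P A) (f : P → ℤ → A) :
    P → ℤ → A :=
  fun p m => ∑' j : ℤ, actTerm v X f p m j

/-- The terms of `∑_{i ≥ 0, j ∈ ℤ} F_ij B_ij`, where `B_ij` stands for `𝓜^i 𝓛^j`. -/
def sumTerm [AddCommMonoid A] [Module ℂ A] (F : ℕ → ℤ → ℂ) (B : ℕ → ℤ → ShiftSeries P A)
    (l : ℤ) (p : P) : ℕ × ℤ → A :=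
  fun q => F q.1 q.2 • B q.1 q.2 l p

/-- The sum `∑_{i ≥ 0, j ∈ ℤ} F_ij B_ij`, where `B_ij` stands for `𝓜^i 𝓛^j`. -/
def evalSeries [AddCommMonoid A] [Module ℂ A] [TopologicalSpace A] (F : ℕ → ℤ → ℂ)
    (B : ℕ → ℤ → ShiftSeries P A) : ShiftSeries P A :=
  fun l p => ∑' q : ℕ × ℤ, sumTerm F B l p q

/-- The part `∑_{j ≥ 0} c_j Θ^j` of `∑ c_j Θ^j`. -/
def partGe [Zero A] (X : ShiftSeries P A) : ShiftSeries P A :=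
  fun j p => if 0 ≤ j then X j p else 0

/-- The part `∑_{j > 0} c_j Θ^j` of `∑ c_j Θ^j`. -/
def partGt [Zero A] (X : ShiftSeries P A) : ShiftSeries P A :=
  fun j p => if 0 < j then X j p else 0

/-- The part `∑_{j > 0} c_j (Θ^j - 1)` of `∑ c_j Θ^j`. -/
def partGtSub [Ring A] [TopologicalSpace A] (X : ShiftSeries P A) : ShiftSeries P A :=
  fun j p => if 0 < j then X j p else if j = 0 then -∑' i : ℤ, partGt X i p else 0

end Series

/-! ## Indices, times, charges -/

/-- The index set `𝒮 = 𝕊 ∪ 𝕊̄`: `inl k` is `k` and `inr k` is `k̄`.  The index `1` is `0 : Fin N`. -/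
abbrev Idx (N : ℕ) := Fin N ⊕ Fin N

/-- Formal power series in the times `t_{ja}`, `j ≥ 1`, `a ∈ 𝒮`. -/
abbrev TimeRing (N : ℕ) := MvPowerSeries (ℕ+ × Idx N) ℂ

/-- `N × N` matrices of formal power series in the times. -/
abbrev Mat (N : ℕ) := Matrix (Fin N) (Fin N) (TimeRing N)

/-- The time `t_{ja}` for `j ≥ 1`, and `0` for `j ≤ 0`. -/
def time {N : ℕ} (a : Idx N) (j : ℤ) : TimeRing N :=
  if h : 0 < j then MvPowerSeries.X (⟨j.toNat, by omega⟩, a) else 0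

/-- The zero charge sector: `s : 𝒮 → ℤ` with `∑ s_a = 0`. -/
def Charge (N : ℕ) : AddSubgroup (Idx N → ℤ) where
  carrier := {s | ∑ a, s a = 0}
  zero_mem' := by simp
  add_mem' := by
    intro x y hx hy
    simp only [Set.mem_ofPred_eq, Pi.add_apply, Finset.sum_add_distrib] at *
    omega
  neg_mem' := by
    intro x hx
    simp only [Set.mem_ofPred_eq, Pi.neg_apply, Finset.sum_neg_distrib] at *
    omega

/-- The direction of the charge preserving shift `T_{(a,b)}`: `s_a ↦ s_a + 1`, `s_b ↦ s_b - 1`. -/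
def step {N : ℕ} (a b : Idx N) : Charge N :=
  ⟨Pi.single a 1 - Pi.single b 1, by
    change ∑ c, (Pi.single a (1 : ℤ) - Pi.single b (1 : ℤ) : Idx N → ℤ) c = 0
    simp only [Pi.sub_apply, Finset.sum_sub_distrib, Finset.sum_pi_single', Finset.mem_univ,
      if_true, sub_self]⟩

/-! ## Matrix operators -/

/-- Formal series `∑_j X_j(n) Λ^j`, `(Λ f)(n) = f(n + 1)`, with matrix coefficients. -/
abbrev MatSeries (N : ℕ) := ShiftSeries ℤ (Mat N)

/-- `E_kk Λ^j`. -/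
def EΛ {N : ℕ} (k : Fin N) (j : ℤ) : MatSeries N := monomial j (fun _ => Matrix.single k k 1)

/-- An associative algebra `𝔤` of formal series in `Λ`: products of its elements converge
coefficientwise, stay in `𝔤` and are associative; `𝔤` contains `1`, `Λ`, `Λ⁻¹`, multiplication
by `n`, and the matrix units `E_kk`. -/
structure LaurentAlgebra (N : ℕ) where
  carrier : Submodule ℂ (MatSeries N)
  summable_mul : ∀ X ∈ carrier, ∀ Y ∈ carrier, ∀ j n : ℤ,
    Summable fun i : ℤ => X i n * Y (j - i) (n + i • 1)
  mul_mem : ∀ X ∈ carrier, ∀ Y ∈ carrier, mul 1 X Y ∈ carrier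
  mul_assoc : ∀ X ∈ carrier, ∀ Y ∈ carrier, ∀ Z ∈ carrier,
    mul 1 (mul 1 X Y) Z = mul 1 X (mul 1 Y Z)
  one_mem : one ∈ carrier
  shift_mem : monomial 1 (fun _ => 1) ∈ carrier
  shift_inv_mem : monomial (-1) (fun _ => 1) ∈ carrier
  n_mem : monomial 0 (fun n : ℤ => (n : Mat N)) ∈ carrier
  E_mem : ∀ k : Fin N, EΛ k 0 ∈ carrier

namespace LaurentAlgebra

variable {N : ℕ} (𝔤 : LaurentAlgebra N)

/-- The elements of `𝔤`. -/
def Elem : Type := 𝔤.carrier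

instance : AddCommGroup 𝔤.Elem := inferInstanceAs (AddCommGroup 𝔤.carrier)

instance : Mul 𝔤.Elem := ⟨fun X Y => ⟨mul 1 X.1 Y.1, 𝔤.mul_mem _ X.2 _ Y.2⟩⟩

instance : One 𝔤.Elem := ⟨⟨one, 𝔤.one_mem⟩⟩

variable {𝔤}

/-- The underlying formal series of an element of `𝔤`. -/
def Elem.series (X : 𝔤.Elem) : MatSeries N := X.1

theorem Elem.series_injective {X Y : 𝔤.Elem} (h : X.series = Y.series) : X = Y := Subtype.ext h

theorem Elem.series_add (X Y : 𝔤.Elem) : (X + Y).series = X.series + Y.series := rfl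

theorem Elem.series_zero : (0 : 𝔤.Elem).series = 0 := rfl

theorem Elem.series_mul (X Y : 𝔤.Elem) : (X * Y).series = mul 1 X.series Y.series := rfl

theorem Elem.series_one : (1 : 𝔤.Elem).series = one := rfl

theorem mul_monomial {N : ℕ} (j : ℤ) (f : ℤ → Mat N) (Y : MatSeries N) (l n : ℤ) :
    mul 1 (monomial j f) Y l n = f n * Y (l - j) (n + j) := by
  unfold mul monomial
  rw [tsum_eq_single j]
  · simp
  · intro i hi
    simp [hi]

theorem mul_one_series {N : ℕ} (X : MatSeries N) : mul 1 X one = X := by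
  funext l n
  unfold mul one monomial
  rw [tsum_eq_single l]
  · simp
  · intro i hi
    have : l - i ≠ 0 := by omega
    simp [this]

variable (𝔤)

instance : Ring 𝔤.Elem where
  __ := (inferInstance : AddCommGroup 𝔤.Elem)
  left_distrib X Y Z := by
    apply Elem.series_injective
    funext j n
    simp only [Elem.series_mul, Elem.series_add, Pi.add_apply, mul, mul_add]
    exact (𝔤.summable_mul _ X.2 _ Y.2 j n).tsum_add (𝔤.summable_mul _ X.2 _ Z.2 j n)
  right_distrib X Y Z := by
    apply Elem.series_injective
    funext j n
    simp only [Elem.series_mul, Elem.series_add, Pi.add_apply, mul, add_mul]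
    exact (𝔤.summable_mul _ X.2 _ Z.2 j n).tsum_add (𝔤.summable_mul _ Y.2 _ Z.2 j n)
  zero_mul X := by
    apply Elem.series_injective
    funext j n
    simp [Elem.series_mul, Elem.series_zero, mul]
  mul_zero X := by
    apply Elem.series_injective
    funext j n
    simp [Elem.series_mul, Elem.series_zero, mul]
  mul_assoc X Y Z := Elem.series_injective (𝔤.mul_assoc _ X.2 _ Y.2 _ Z.2)
  one_mul X := by
    apply Elem.series_injective
    funext j n
    rw [Elem.series_mul, Elem.series_one, one, mul_monomial]
    simp
  mul_one X := Elem.series_injective (mul_one_series _)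

theorem monomial_mul_inv {N : ℕ} (j : ℤ) :
    mul (1 : ℤ) (monomial j fun _ => (1 : Mat N)) (monomial (-j) fun _ => 1) = one := by
  funext l n
  rw [mul_monomial]
  by_cases h : l = 0
  · simp [monomial, one, h]
  · have : ¬ l - j = -j := by omega
    simp [monomial, one, h, this]

/-- The shift `Λ` as an invertible element of `𝔤`. -/
def Λ : 𝔤.Elemˣ where
  val := ⟨monomial 1 (fun _ => 1), 𝔤.shift_mem⟩
  inv := ⟨monomial (-1) (fun _ => 1), 𝔤.shift_inv_mem⟩
  val_inv := Elem.series_injective (monomial_mul_inv 1)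
  inv_val := Elem.series_injective (by
    have := monomial_mul_inv (N := N) (-1)
    rwa [neg_neg] at this)

/-- Multiplication by `n`. -/
def n : 𝔤.Elem := ⟨_, 𝔤.n_mem⟩

/-- The matrix unit `E_kk`. -/
def E (k : Fin N) : 𝔤.Elem := ⟨_, 𝔤.E_mem k⟩

/-- The group `G_-`: invertible series `1 + ∑_{j<0} X_j(n) Λ^j` with inverse of the same form. -/
def Gminus : Set 𝔤.Elemˣ :=
  {U | ∀ V : 𝔤.Elem, V = ↑U ∨ V = ↑U⁻¹ →
    (∀ n, V.series 0 n = 1) ∧ ∀ j > 0, ∀ n, V.series j n = 0}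

/-- The group `G_+`: invertible series `∑_{j≥0} X_j(n) Λ^j` with inverse of the same form. -/
def Gplus : Set 𝔤.Elemˣ :=
  {U | ∀ V : 𝔤.Elem, V = ↑U ∨ V = ↑U⁻¹ → ∀ j < 0, ∀ n, V.series j n = 0}

end LaurentAlgebra

/-- `W₀ = ∑_k E_kk Λ^{s_k} exp(∑_{j≥1} t_{jk} Λ^j)`. -/
def W₀Series {N : ℕ} (s : Charge N) : MatSeries N :=
  ∑ k : Fin N, mul 1 (EΛ k (s.1 (Sum.inl k))) (exp 1 fun j _ => time (Sum.inl k) j • (1 : Mat N))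

/-- `W̄₀ = ∑_k E_kk Λ^{-s_k̄} exp(∑_{j≥1} t_{jk̄} Λ^{-j})`. -/
def W₀barSeries {N : ℕ} (s : Charge N) : MatSeries N :=
  ∑ k : Fin N, mul 1 (EΛ k (-s.1 (Sum.inr k)))
    (exp 1 fun j _ => time (Sum.inr k) (-j) • (1 : Mat N))

/-- A solution of the factorization problem `S(s,t) W₀ g = S̄(s,t) W̄₀`, for all charges `s` of the
zero charge sector and as formal power series in the times `t`, with a fixed `g` whose coefficients
are complex matrices independent of `s` and `t`. -/
structure Factorization {N : ℕ} (𝔤 : LaurentAlgebra N) where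
  g : 𝔤.Elemˣ
  g_const : ∃ g₀ : ℤ → ℤ → Matrix (Fin N) (Fin N) ℂ,
    ∀ j n, (g : 𝔤.Elem).series j n = (g₀ j n).map (algebraMap ℂ (TimeRing N))
  W₀ : Charge N → 𝔤.Elemˣ
  W₀_eq : ∀ s, (W₀ s : 𝔤.Elem).series = W₀Series s
  W₀bar : Charge N → 𝔤.Elemˣ
  W₀bar_eq : ∀ s, (W₀bar s : 𝔤.Elem).series = W₀barSeries s
  S : Charge N → 𝔤.Elemˣ
  S_mem : ∀ s, S s ∈ 𝔤.Gminus
  Sbar : Charge N → 𝔤.Elemˣ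
  Sbar_mem : ∀ s, Sbar s ∈ 𝔤.Gplus
  factorization : ∀ s, S s * W₀ s * g = Sbar s * W₀bar s

namespace Factorization

variable {N : ℕ} {𝔤 : LaurentAlgebra N} (D : Factorization 𝔤) (s : Charge N)

/-- The dressing operator `W = S W₀`. -/
def W : 𝔤.Elemˣ := D.S s * D.W₀ s

/-- The dressing operator `W̄ = S̄ W̄₀`. -/
def Wbar : 𝔤.Elemˣ := D.Sbar s * D.W₀bar s

/-- The Lax operator `L = W Λ W⁻¹`. -/
def L : 𝔤.Elemˣ := D.W s * 𝔤.Λ * (D.W s)⁻¹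

/-- The Lax operator `L̄ = W̄ Λ W̄⁻¹`. -/
def Lbar : 𝔤.Elemˣ := D.Wbar s * 𝔤.Λ * (D.Wbar s)⁻¹

/-- `C_kk = W E_kk W⁻¹`. -/
def C (k : Fin N) : 𝔤.Elem := D.W s * 𝔤.E k * ↑(D.W s)⁻¹

/-- `C̄_kk = W̄ E_kk W̄⁻¹`. -/
def Cbar (k : Fin N) : 𝔤.Elem := D.Wbar s * 𝔤.E k * ↑(D.Wbar s)⁻¹

/-- The Orlov--Schulman operator `M = W n W⁻¹`. -/
def M : 𝔤.Elem := D.W s * 𝔤.n * ↑(D.W s)⁻¹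

/-- The Orlov--Schulman operator `M̄ = W̄ n W̄⁻¹`. -/
def Mbar : 𝔤.Elem := D.Wbar s * 𝔤.n * ↑(D.Wbar s)⁻¹

/-- `F(M, L) = ∑ F_ij M^i L^j`. -/
def evalML (F : ℕ → ℤ → ℂ) : MatSeries N :=
  evalSeries F fun i j => (D.M s ^ i * ↑(D.L s ^ j) : 𝔤.Elem).series

/-- `F(M̄, L̄⁻¹) = ∑ F_ij M̄^i L̄^{-j}`. -/
def evalMLbar (F : ℕ → ℤ → ℂ) : MatSeries N :=
  evalSeries F fun i j => (D.Mbar s ^ i * ↑((D.Lbar s)⁻¹ ^ j) : 𝔤.Elem).series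

/-- The string equation `E_11 ∑_k F_k(M, L) C_kk = E_11 ∑_k F_k̄(M̄, L̄⁻¹) C̄_kk`. -/
def StringEquation [NeZero N] (F : Idx N → ℕ → ℤ → ℂ) : Prop :=
  mul 1 (EΛ 0 0) (∑ k : Fin N, mul 1 (D.evalML s (F (Sum.inl k))) (D.C s k).series) =
    mul 1 (EΛ 0 0) (∑ k : Fin N, mul 1 (D.evalMLbar s (F (Sum.inr k))) (D.Cbar s k).series)

end Factorization

/-- `χ(z) = {z^n I_N}_n`. -/
def χ (N : ℕ) : ℤ → ℤ → Mat N := fun n m => if m = n then 1 else 0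

namespace Factorization

variable {N : ℕ} [NeZero N] {𝔤 : LaurentAlgebra N} (D : Factorization 𝔤)

/-- The scalar wave functions `Ψ_k = ψ_{1k}` and `Ψ_k̄ = ψ̄_{1k}`, where `ψ = W χ`, `ψ̄ = W̄ χ`:
`D.Ψ a n s m` is the coefficient of `z^m` at the value `n` of the discrete variable. -/
def Ψ (a : Idx N) (n : ℤ) (s : Charge N) (m : ℤ) : TimeRing N :=
  match a with
  | Sum.inl k => act 1 (D.W s : 𝔤.Elem).series (χ N) n m 0 k
  | Sum.inr k => act 1 (D.Wbar s : 𝔤.Elem).series (χ N) n m 0 k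

/-! ## Scalar operators

For fixed `n` these are series in a charge preserving shift, in the direction `v`, with coefficients
that are functions of the charges.  The scalar operators without bar are obtained for
`v = dir a₀ a`, the barred ones for `v = dirBar b₀ a`. -/

/-- The direction of the shift `𝒯_a`: `T_{(1,a₀)}` for `a = 1` and `T_{(a,1)}` for `a ≠ 1`. -/
def dir (a₀ a : Idx N) : Charge N :=
  if a = Sum.inl 0 then step (Sum.inl 0) a₀ else step a (Sum.inl 0)

/-- The direction of the shift `𝒯̄_a`: `T_{(1̄,b₀)}` for `a = 1̄` and `T_{(a,1̄)}` for `a ≠ 1̄`. -/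
def dirBar (b₀ a : Idx N) : Charge N :=
  if a = Sum.inr 0 then step (Sum.inr 0) b₀ else step a (Sum.inr 0)

/-- The coefficients of the scalar dressing operator, in terms of `S = 1 + φ₁ Λ⁻¹ + ⋯` and
`S̄ = φ̄₀ + φ̄₁ Λ + ⋯`: the coefficient of `𝒯_a^{-i}`, `i ≥ 0`, is `φ_{i,11}` for `a = 1`,
`φ_{i+1,1k}` for `a = k ≠ 1` and `φ̄_{i,1k}` for `a = k̄`. -/
def K (a : Idx N) (n : ℤ) : ShiftSeries (Charge N) (TimeRing N) := fun j s =>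
  if j ≤ 0 then
    match a with
    | Sum.inl k => if k = 0 then (D.S s : 𝔤.Elem).series j n 0 0
        else (D.S s : 𝔤.Elem).series (j - 1) n 0 k
    | Sum.inr k => (D.Sbar s : 𝔤.Elem).series (-j) n 0 k
  else 0

/-- The leading coefficients `φ_{1,1k}`, `k ≠ 1`, and `φ̄_{0,1k}` of the scalar dressing operators
are invertible (for `a = 1` the leading coefficient is `1`). -/
def Nondegenerate : Prop :=
  ∀ (s : Charge N) (n : ℤ),
    (∀ k : Fin N, k ≠ 0 → IsUnit ((D.S s : 𝔤.Elem).series (-1) n 0 k)) ∧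
    ∀ k : Fin N, IsUnit ((D.Sbar s : 𝔤.Elem).series 0 n 0 k)

/-- The scalar Lax operator `K_a 𝒯_a K_a⁻¹`. -/
def scalarL (v : Charge N) (a : Idx N) (n : ℤ) : ShiftSeries (Charge N) (TimeRing N) :=
  mul v (mul v (D.K a n) (monomial 1 fun _ => 1)) (lowerInv v (D.K a n))

/-- The inverse `K_a 𝒯_a⁻¹ K_a⁻¹` of the scalar Lax operator. -/
def scalarLinv (v : Charge N) (a : Idx N) (n : ℤ) : ShiftSeries (Charge N) (TimeRing N) :=
  mul v (mul v (D.K a n) (monomial (-1) fun _ => 1)) (lowerInv v (D.K a n))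

/-- `∑_{j≥1} t_{ja} 𝒯_a^j`. -/
def timeSeries (a : Idx N) : ShiftSeries (Charge N) (TimeRing N) := fun j _ => time a j

/-- `W_a = K_a exp(∑_{j≥1} t_{ja} 𝒯_a^j)`. -/
def scalarW (v : Charge N) (a : Idx N) (n : ℤ) : ShiftSeries (Charge N) (TimeRing N) :=
  mul v (D.K a n) (exp v (timeSeries a))

/-- `W_a⁻¹ = exp(-∑_{j≥1} t_{ja} 𝒯_a^j) K_a⁻¹`. -/
def scalarWinv (v : Charge N) (a : Idx N) (n : ℤ) : ShiftSeries (Charge N) (TimeRing N) :=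
  mul v (exp v (-timeSeries a)) (lowerInv v (D.K a n))

/-- `sg(a) = 1` for `a ∈ 𝕊` and `sg(a) = -1` for `a ∈ 𝕊̄`. -/
def sg (a : Idx N) : ℤ := if a.isLeft then 1 else -1

/-- `ν_a = 1` for `a ∈ 𝕊 - {1}` and `ν_a = 0` otherwise. -/
def ν (a : Idx N) : ℤ := if a.isLeft ∧ a ≠ Sum.inl 0 then 1 else 0

/-- The scalar Orlov--Schulman operator `n - ν_a + sg(a) W_a s_a W_a⁻¹`. -/
def scalarM (v : Charge N) (a : Idx N) (n : ℤ) : ShiftSeries (Charge N) (TimeRing N) :=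
  monomial 0 (fun _ => ((n - ν a : ℤ) : TimeRing N)) +
    sg a • mul v (mul v (D.scalarW v a n)
      (monomial 0 fun s => ((s.1 a : ℤ) : TimeRing N))) (D.scalarWinv v a n)

/-- The products `𝓜_a^i 𝓛_a^j`. -/
def scalarB (v : Charge N) (a : Idx N) (n : ℤ) (i : ℕ) (j : ℤ) :
    ShiftSeries (Charge N) (TimeRing N) :=
  mul v (npow v (D.scalarM v a n) i) (zpow v (D.scalarL v a n) (D.scalarLinv v a n) j)

/-- `F_a(𝓜_a, 𝓛_a) = ∑ F_{aij} 𝓜_a^i 𝓛_a^j`. -/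
def scalarF (v : Charge N) (F : Idx N → ℕ → ℤ → ℂ) (a : Idx N) (n : ℤ) :
    ShiftSeries (Charge N) (TimeRing N) :=
  evalSeries (F a) (D.scalarB v a n)

/-- The projection `+` for the shift `𝒯_a`. -/
def plus (a : Idx N) (X : ShiftSeries (Charge N) (TimeRing N)) :
    ShiftSeries (Charge N) (TimeRing N) :=
  if a = Sum.inl 0 then partGe X else partGt X

/-- The projection `+` for the shift `𝒯̄_a`. -/
def plusBar (b₀ a : Idx N) (X : ShiftSeries (Charge N) (TimeRing N)) :
    ShiftSeries (Charge N) (TimeRing N) :=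
  if a = Sum.inl 0 then partGe X
  else if a = Sum.inr 0 ∧ b₀ = Sum.inl 0 then partGt X
  else partGtSub X

/-- For the shifts with directions `v a` and the projections `pr a`, and at the charge `s`:
all the sums below converge, and
`F_a(𝓜_a, 𝓛_a)(Ψ_a) = (∑_{a'} F_{a'}(𝓜_{a'}, 𝓛_{a'})_+)(Ψ_a)` for all `a` and all `n`. -/
def WaveEquations (v : Idx N → Charge N)
    (pr : Idx N → ShiftSeries (Charge N) (TimeRing N) → ShiftSeries (Charge N) (TimeRing N))
    (F : Idx N → ℕ → ℤ → ℂ) (s : Charge N) : Prop :=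
  ∀ (a : Idx N) (n m : ℤ),
    (∀ (l : ℤ) (s' : Charge N), Summable (sumTerm (F a) (D.scalarB (v a) a n) l s')) ∧
    Summable (actTerm (v a) (D.scalarF (v a) F a n) (D.Ψ a n) s m) ∧
    (∀ a', Summable (actTerm (v a') (pr a' (D.scalarF (v a') F a' n)) (D.Ψ a n) s m)) ∧
    act (v a) (D.scalarF (v a) F a n) (D.Ψ a n) s m =
      ∑ a', act (v a') (pr a' (D.scalarF (v a') F a' n)) (D.Ψ a n) s m

end Factorization

/-- The coefficients of `F(x,y) = ∑_{i ≥ 0, j ∈ ℤ} F_ij x^i y^j`: the powers of `y` are bounded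
above, and each of them has a polynomial in `x` as its coefficient. -/
def Admissible (F : ℕ → ℤ → ℂ) : Prop :=
  (∃ r : ℤ, ∀ i j, r < j → F i j = 0) ∧ ∀ j, {i | F i j ≠ 0}.Finite

end Toda

end

noncomputable section

namespace Toda

set_option linter.unusedSectionVars false

/-! ## Weight filtrations -/

/-! For each index `a'` let c_j be the coefficient at s of the j-th power of the shift in the plus
part of F_{a'}(M_{a'}, L_{a'}), a function of n, and let v_{a'} be the direction of that shift. Take
the operator E_11 ∑_k F_k(M, L) C_kk and subtract E_11 ∑_{a'} ∑_j c_j W(s + j v_{a'}) W(s)⁻¹. The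
difference Q is the same on both sides of the factorization problem: the first term by the string
equation, the second because W̄ = W g with g independent of s, whence W(s')W(s)⁻¹ = W̄(s')W̄(s)⁻¹
(`sideW_mul_inv`).

Multiply Q by S(s) on the right. The first row of the first term turns into the coefficients of the
scalar products F_a K_a (`serSum_mul_serS_eq`). In the second, W(s')W(s)⁻¹S(s) is S(s') times a
diagonal matrix of shifts, because the exponentials cancel, so shifted coefficients of K_a appear
(`serR_mul_serS_eq`). The projections are made so that the two agree in every nonnegative power of Λ
(`tsum_mul_K_self`, `tsum_mul_K_of_ne`). Hence QS, and with it Q, has only negative powers. The same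
computation with S̄ leaves only nonnegative powers, so Q = 0. Multiplying Q = 0 by W(s) or W̄(s)
instead gives the wave equations, since W(s')W(s)⁻¹ carries the wave functions at s to those at s'.

The translation between matrix and scalar operators (`scalarW_sideIdx`, `serSum_mul_serW_eq`) rests
on the factor E_kk Λ^{s_k} of W₀ and its barred analogue: raising the charge s_a by one has the
effect of one more power of Λ^{±1}, so n and the charge enter the Orlov–Schulman eigenvalues
together.

Convergence is controlled by giving t_{ja} weight j. On the unbarred side the coefficient of Λ^j
then has weight at least j - d for a fixed d, and on the barred side the same holds in powers of
Λ⁻¹. Such series form a ring, `BoundedSeries`, in which all rearrangements are legitimate. The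
algebra 𝔤 is arbitrary, so its elements must be matched with this ring; the only delicate one is the
inverse of W₀ (`eq_inv_of_mul_eq_one`). -/

/-- A filtration of a topological algebra by closed subspaces such that every family tending to
zero with respect to the filtration is summable. -/
class WeightFiltration (A : Type*) [Ring A] [Algebra ℂ A] [TopologicalSpace A] where
  fil : ℤ → Submodule ℂ A
  fil_nonpos : ∀ w ≤ 0, fil w = ⊤
  fil_anti : Antitone fil
  fil_mul : ∀ {a b : ℤ} {x y : A}, x ∈ fil a → y ∈ fil b → x * y ∈ fil (a + b)
  fil_closed : ∀ w, IsClosed (fil w : Set A)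
  summable_of_fil : ∀ {ι : Type} (f : ι → A), (∀ w, {i | f i ∉ fil w}.Finite) → Summable f

open WeightFiltration

/-- Families tending to zero with respect to the weight filtration. -/
def WSummable {A : Type*} [Ring A] [Algebra ℂ A] [TopologicalSpace A] [WeightFiltration A]
    {ι : Type} (f : ι → A) : Prop :=
  ∀ w, {i | f i ∉ fil (A := A) w}.Finite

section Filtration

variable {A : Type*} [Ring A] [Algebra ℂ A] [TopologicalSpace A] [WeightFiltration A]
  {ι κ : Type}

theorem mem_fil_of_le {a b : ℤ} (h : b ≤ a) {x : A} (hx : x ∈ fil (A := A) a) :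
    x ∈ fil (A := A) b :=
  fil_anti h hx

theorem mem_fil_of_nonpos {w : ℤ} (h : w ≤ 0) (x : A) : x ∈ fil (A := A) w := by
  rw [fil_nonpos w h]; trivial

theorem fil_mul_right {w : ℤ} {x : A} (hx : x ∈ fil (A := A) w) (y : A) :
    x * y ∈ fil (A := A) w := by
  simpa using fil_mul hx (mem_fil_of_nonpos le_rfl y)

theorem fil_mul_left {w : ℤ} {y : A} (x : A) (hy : y ∈ fil (A := A) w) :
    x * y ∈ fil (A := A) w := by
  simpa using fil_mul (mem_fil_of_nonpos le_rfl x) hy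

theorem tsum_mem_fil {w : ℤ} {f : ι → A} (h : ∀ i, f i ∈ fil (A := A) w) :
    ∑' i, f i ∈ fil (A := A) w :=
  tsum_mem (fil_closed w) h

theorem WSummable.summable {f : ι → A} (h : WSummable f) : Summable f := summable_of_fil f h

theorem WSummable.comp_injective {f : ι → A} (h : WSummable f) {g : κ → ι}
    (hg : Function.Injective g) : WSummable fun k => f (g k) := fun w =>
  (h w).preimage hg.injOn

theorem WSummable.mono {f g : ι → A} (h : WSummable f)
    (hg : ∀ w i, f i ∈ fil (A := A) w → g i ∈ fil (A := A) w) : WSummable g := fun w =>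
  (h w).subset fun i hi hf => hi (hg w i hf)

theorem WSummable.mul_right {f : ι → A} (h : WSummable f) (c : ι → A) :
    WSummable fun i => f i * c i :=
  h.mono fun _ _ hf => fil_mul_right hf _

theorem wsummable_of_Icc {f : ℤ → A}
    (h : ∀ w, ∃ a b : ℤ, ∀ i, i < a ∨ b < i → f i ∈ fil (A := A) w) : WSummable f := by
  intro w
  obtain ⟨a, b, hab⟩ := h w
  refine (Set.finite_Icc a b).subset fun i hi => ?_
  by_contra hc
  apply hi
  apply hab
  rw [Set.mem_Icc] at hc
  omega

/-- Rows and columns of a family tending to zero again tend to zero, so the hypothesis on the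
product index supplies every summability that Fubini needs. -/
theorem WSummable.tsum_comm [IsTopologicalRing A] [T2Space A] {f : ι → κ → A}
    (h : WSummable (Function.uncurry f)) : ∑' i, ∑' k, f i k = ∑' k, ∑' i, f i k :=
  (Summable.tsum_comm' h.summable
    (fun i => (h.comp_injective (g := fun k => (i, k)) fun _ _ e => (Prod.mk.inj e).2).summable)
    (fun k => (h.comp_injective (g := fun i => (i, k))
      fun _ _ e => (Prod.mk.inj e).1).summable)).symm

end Filtration

/-! ## Series of bounded degree -/

section Series

variable {P A : Type*} [AddCommGroup P] [Ring A] [Algebra ℂ A] [TopologicalSpace A]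
  [WeightFiltration A]

/-- Up to terms of large weight, the powers of the shift are at most `d`. -/
def DegreeLE (d : ℤ) (X : ShiftSeries P A) : Prop := ∀ j p, X j p ∈ fil (A := A) (j - d)

theorem DegreeLE.mono {d e : ℤ} (h : d ≤ e) {X : ShiftSeries P A} (hX : DegreeLE d X) :
    DegreeLE e X := fun j p => mem_fil_of_le (by omega) (hX j p)

theorem degreeLE_monomial (j : ℤ) (f : P → A) : DegreeLE j (monomial j f) := by
  intro i p
  unfold monomial
  split_ifs with h
  · exact mem_fil_of_nonpos (by omega) _
  · exact Submodule.zero_mem _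

theorem degreeLE_of_lower {d : ℤ} {X : ShiftSeries P A} (h : ∀ j, d < j → ∀ p, X j p = 0) :
    DegreeLE d X := by
  intro j p
  rcases lt_or_ge d j with hj | hj
  · rw [h j hj p]; exact Submodule.zero_mem _
  · exact mem_fil_of_nonpos (by omega) _

theorem DegreeLE.add {d : ℤ} {X Y : ShiftSeries P A} (hX : DegreeLE d X) (hY : DegreeLE d Y) :
    DegreeLE d (X + Y) := fun j p => Submodule.add_mem _ (hX j p) (hY j p)

theorem DegreeLE.sum {ι : Type*} {d : ℤ} {X : ι → ShiftSeries P A} {s : Finset ι}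
    (h : ∀ i ∈ s, DegreeLE d (X i)) : DegreeLE d (∑ i ∈ s, X i) := by
  intro j p
  simp only [Finset.sum_apply]
  exact Submodule.sum_mem _ fun i hi => h i hi j p

/-- For large i the first factor has large weight, for very negative i the second one does. The
evaluation points play no role, so `q` is arbitrary. -/
theorem DegreeLE.wsummable_mul {d e : ℤ} {X Y : ShiftSeries P A} (hX : DegreeLE d X)
    (hY : DegreeLE e Y) (j : ℤ) (p : P) (q : ℤ → P) :
    WSummable fun i : ℤ => X i p * Y (j - i) (q i) := by
  refine wsummable_of_Icc fun w => ⟨j - e - w, d + w, fun i hi => ?_⟩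
  rcases hi with hi | hi
  · exact fil_mul_left _ (mem_fil_of_le (by omega) (hY _ _))
  · exact fil_mul_right (mem_fil_of_le (by omega) (hX _ _)) _

theorem DegreeLE.mul {d e : ℤ} {X Y : ShiftSeries P A} (hX : DegreeLE d X)
    (hY : DegreeLE e Y) (v : P) : DegreeLE (d + e) (mul v X Y) := fun j p =>
  tsum_mem_fil fun i => by
    have := fil_mul (hX i p) (hY (j - i) (p + i • v))
    rwa [show i - d + (j - i - e) = j - (d + e) by ring] at this

/-- Series which contain only powers of the shift above some bound. -/
def BoundedBelow (X : ShiftSeries P A) : Prop := ∃ m : ℤ, ∀ j < m, ∀ p, X j p = 0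

variable [IsTopologicalRing A] [T2Space A]

/-- Associativity is an exchange of two sums. The third hypothesis is indexed by the exponents taken
from X and Y; the substitution l = i + k passes to the exponent of the product XY. -/
theorem mul_assoc_of_wsummable (v : P) {X Y Z : ShiftSeries P A}
    (h₁ : ∀ j p, WSummable fun i : ℤ => X i p * Y (j - i) (p + i • v))
    (h₂ : ∀ j p, WSummable fun i : ℤ => Y i p * Z (j - i) (p + i • v))
    (h₃ : ∀ j p, WSummable fun q : ℤ × ℤ =>
      X q.1 p * (Y q.2 (p + q.1 • v) * Z (j - q.1 - q.2) (p + q.1 • v + q.2 • v))) :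
    mul v (mul v X Y) Z = mul v X (mul v Y Z) := by
  funext j p
  calc mul v (mul v X Y) Z j p
      = ∑' l : ℤ, ∑' i : ℤ, X i p * (Y (l - i) (p + i • v) * Z (j - l) (p + l • v)) := by
        refine tsum_congr fun l => ?_
        rw [mul, ← (h₁ l p).summable.tsum_mul_right]
        simp only [mul_assoc]
    _ = ∑' i : ℤ, ∑' l : ℤ, X i p * (Y (l - i) (p + i • v) * Z (j - l) (p + l • v)) := by
        refine WSummable.tsum_comm ?_
        refine ((h₃ j p).comp_injective (g := fun q : ℤ × ℤ => (q.2, q.1 - q.2)) ?_).mono ?_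
        · rintro ⟨a, b⟩ ⟨c, d⟩ h
          simp only [Prod.mk.injEq] at h ⊢
          omega
        · rintro w ⟨l, i⟩ h
          simp only [Function.uncurry_apply_pair] at h ⊢
          rwa [show j - i - (l - i) = j - l by ring, add_assoc, ← add_smul,
            show i + (l - i) = l by ring] at h
    _ = mul v X (mul v Y Z) j p := by
        refine tsum_congr fun i => ?_
        rw [mul, ← (h₂ (j - i) (p + i • v)).summable.tsum_mul_left]
        rw [← (Equiv.addRight i).tsum_eq]
        refine tsum_congr fun k => ?_
        simp only [Equiv.coe_addRight]
        rw [show k + i - i = k by ring, show j - (k + i) = j - i - k by ring, add_assoc,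
          ← add_smul, add_comm i k]

theorem mul_assoc_of_degreeLE (v : P) {X Y Z : ShiftSeries P A} {d e f : ℤ}
    (hX : DegreeLE d X) (hY : DegreeLE e Y) (hZ : DegreeLE f Z) :
    mul v (mul v X Y) Z = mul v X (mul v Y Z) := by
  refine mul_assoc_of_wsummable v (fun j p => hX.wsummable_mul hY j p _)
    (fun j p => hY.wsummable_mul hZ j p _) fun j p w => ?_
  -- Modulo weight w the three exponents are at most d + w, e + w and f + w. Their sum is j, so each
  -- is also bounded below.
  refine ((Set.finite_Icc (j - f - w - (e + w)) (d + w)).prod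
    (Set.finite_Icc (j - f - w - (d + w)) (e + w))).subset ?_
  rintro ⟨i, k⟩ h
  simp only [Set.mem_ofPred_eq] at h
  by_contra hc
  simp only [Set.mem_prod, Set.mem_Icc] at hc
  apply h
  by_cases hi : d + w < i
  · exact fil_mul_right (mem_fil_of_le (by omega) (hX _ _)) _
  by_cases hk : e + w < k
  · exact fil_mul_left _ (fil_mul_right (mem_fil_of_le (by omega) (hY _ _)) _)
  · exact fil_mul_left _ (fil_mul_left _ (mem_fil_of_le (by omega) (hZ _ _)))

/-- Exponents of X and Y are bounded below by assumption and above modulo weight, so nothing is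
required of Z. This is what allows a statement about an inverse in 𝔤 whose degree is not known. -/
theorem mul_assoc_of_boundedBelow (v : P) {X Y Z : ShiftSeries P A} {d e : ℤ}
    (hX : DegreeLE d X) (hX' : BoundedBelow X) (hY : DegreeLE e Y) (hY' : BoundedBelow Y) :
    mul v (mul v X Y) Z = mul v X (mul v Y Z) := by
  obtain ⟨m, hm⟩ := hX'
  obtain ⟨k₀, hk₀⟩ := hY'
  refine mul_assoc_of_wsummable v (fun j p => hX.wsummable_mul hY j p _) (fun j p => ?_)
    fun j p w => ?_
  · refine wsummable_of_Icc fun w => ⟨k₀, e + w, fun i hi => ?_⟩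
    rcases hi with hi | hi
    · simp [hk₀ i hi]
    · exact fil_mul_right (mem_fil_of_le (by omega) (hY _ _)) _
  refine ((Set.finite_Icc m (d + w)).prod (Set.finite_Icc k₀ (e + w))).subset ?_
  rintro ⟨i, k⟩ h
  simp only [Set.mem_ofPred_eq] at h
  by_contra hc
  simp only [Set.mem_prod, Set.mem_Icc] at hc
  apply h
  by_cases hi : d + w < i
  · exact fil_mul_right (mem_fil_of_le (by omega) (hX _ _)) _
  by_cases hk : e + w < k
  · exact fil_mul_left _ (fil_mul_right (mem_fil_of_le (by omega) (hY _ _)) _)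
  by_cases hi' : i < m
  · simp [hm i hi']
  by_cases hk' : k < k₀
  · simp [hk₀ k hk']
  omega

theorem monomial_mul (v : P) (j : ℤ) (f : P → A) (Y : ShiftSeries P A) (l : ℤ) (p : P) :
    mul v (monomial j f) Y l p = f p * Y (l - j) (p + j • v) := by
  unfold mul monomial
  rw [tsum_eq_single j]
  · simp
  · intro i hi
    simp [hi]

theorem mul_monomial (v : P) (X : ShiftSeries P A) (j : ℤ) (f : P → A) (l : ℤ) (p : P) :
    mul v X (monomial j f) l p = X (l - j) p * f (p + (l - j) • v) := by
  unfold mul monomial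
  rw [tsum_eq_single (l - j)]
  · simp
  · intro i hi
    rw [if_neg (by omega), mul_zero]

/-- Multiplication of an infinite sum of series, of uniformly bounded degree. -/
theorem tsum_mul_series {ι : Type} (v : P) (X : ι → ShiftSeries P A) {Y : ShiftSeries P A}
    {d e : ℤ} (hX : ∀ i, DegreeLE d (X i)) (hs : ∀ j p, WSummable fun i => X i j p)
    (hY : DegreeLE e Y) (l : ℤ) (p : P) :
    mul v (fun j p => ∑' i, X i j p) Y l p = ∑' i, mul v (X i) Y l p := by
  calc mul v (fun j p => ∑' i, X i j p) Y l p
      = ∑' j : ℤ, ∑' i, X i j p * Y (l - j) (p + j • v) := by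
        refine tsum_congr fun j => ?_
        rw [(hs j p).summable.tsum_mul_right]
    _ = ∑' i, mul v (X i) Y l p := by
        refine WSummable.tsum_comm fun w => ?_
        -- The uniform bounds d and e leave finitely many j modulo weight w, and for each of them
        -- only finitely many i matter.
        refine ((Set.finite_Icc (l - e - w) (d + w)).biUnion
          (t := fun j => Prod.mk j '' {i | X i j p ∉ fil (A := A) w}) fun j _ =>
            (hs j p w).image _).subset ?_
        rintro ⟨j, i⟩ h
        simp only [Set.mem_ofPred_eq, Function.uncurry_apply_pair] at h
        simp only [Set.mem_iUnion, Set.mem_image, Set.mem_ofPred_eq, Prod.mk.injEq]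
        have hj : j ∈ Set.Icc (l - e - w) (d + w) := by
          by_contra hc
          simp only [Set.mem_Icc] at hc
          apply h
          by_cases hj : d + w < j
          · exact fil_mul_right (mem_fil_of_le (by omega) (hX i _ _)) _
          · exact fil_mul_left _ (mem_fil_of_le (by omega) (hY _ _))
        exact ⟨j, hj, i, fun hc => h (fil_mul_right hc _), rfl, rfl⟩

end Series

/-! ## The ring of series of bounded degree -/

/-- The series in the shift by `v` with bounded degree, as an additive group. -/
def boundedSeries (P A : Type*) [AddCommGroup P] [Ring A] [Algebra ℂ A] [TopologicalSpace A]
    [WeightFiltration A] : AddSubgroup (ShiftSeries P A) where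
  carrier := {X | ∃ d, DegreeLE d X}
  zero_mem' := ⟨0, fun _ _ => Submodule.zero_mem _⟩
  add_mem' := by
    rintro X Y ⟨d, hd⟩ ⟨e, he⟩
    exact ⟨max d e, (hd.mono (le_max_left d e)).add (he.mono (le_max_right d e))⟩
  neg_mem' := by
    rintro X ⟨d, hd⟩
    exact ⟨d, fun j p => Submodule.neg_mem _ (hd j p)⟩

/-- The ring of series of bounded degree in the shift by `v`. -/
def BoundedSeries {P : Type*} (A : Type*) [AddCommGroup P] [Ring A] [Algebra ℂ A]
    [TopologicalSpace A] [WeightFiltration A] (_v : P) : Type _ := boundedSeries P A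

namespace BoundedSeries

variable {P A : Type*} [AddCommGroup P] [Ring A] [Algebra ℂ A] [TopologicalSpace A]
  [WeightFiltration A] {v : P}

instance : AddCommGroup (BoundedSeries A v) := inferInstanceAs (AddCommGroup (boundedSeries P A))

/-- The underlying series. -/
def series (X : BoundedSeries A v) : ShiftSeries P A := X.1

/-- A series of bounded degree as an element of the ring. -/
def mk (X : ShiftSeries P A) {d : ℤ} (h : DegreeLE d X) : BoundedSeries A v := ⟨X, d, h⟩

@[simp] theorem series_mk (X : ShiftSeries P A) {d : ℤ} (h : DegreeLE d X) :
    (mk X h : BoundedSeries A v).series = X := rfl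

theorem exists_degreeLE (X : BoundedSeries A v) : ∃ d, DegreeLE d X.series := X.2

@[ext] theorem ext {X Y : BoundedSeries A v} (h : X.series = Y.series) : X = Y := Subtype.ext h

instance : One (BoundedSeries A v) := ⟨mk one (degreeLE_monomial 0 _)⟩

instance : Mul (BoundedSeries A v) :=
  ⟨fun X Y => ⟨mul v X.1 Y.1, by
    obtain ⟨d, hd⟩ := X.2
    obtain ⟨e, he⟩ := Y.2
    exact ⟨d + e, hd.mul he v⟩⟩⟩

@[simp] theorem series_zero : (0 : BoundedSeries A v).series = 0 := rfl

@[simp] theorem series_add (X Y : BoundedSeries A v) :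
    (X + Y).series = X.series + Y.series := rfl

@[simp] theorem series_neg (X : BoundedSeries A v) : (-X).series = -X.series := rfl

@[simp] theorem series_sub (X Y : BoundedSeries A v) :
    (X - Y).series = X.series - Y.series := rfl

@[simp] theorem series_mul (X Y : BoundedSeries A v) :
    (X * Y).series = Toda.mul v X.series Y.series := rfl

@[simp] theorem series_one : (1 : BoundedSeries A v).series = one := rfl

@[simp] theorem series_sum {ι : Type*} (s : Finset ι) (X : ι → BoundedSeries A v) :
    (∑ i ∈ s, X i).series = ∑ i ∈ s, (X i).series :=
  map_sum (boundedSeries P A).subtype X s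

theorem wsummable_mul (X Y : BoundedSeries A v) (j : ℤ) (p : P) :
    WSummable fun i : ℤ => X.series i p * Y.series (j - i) (p + i • v) := by
  obtain ⟨d, hd⟩ := X.2
  obtain ⟨e, he⟩ := Y.2
  exact hd.wsummable_mul he j p _

variable [IsTopologicalRing A] [T2Space A]

instance : Ring (BoundedSeries A v) where
  __ := (inferInstance : AddCommGroup (BoundedSeries A v))
  left_distrib X Y Z := by
    ext j p
    simp only [series_mul, series_add, Pi.add_apply, Toda.mul, mul_add]
    exact (wsummable_mul X Y j p).summable.tsum_add (wsummable_mul X Z j p).summable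
  right_distrib X Y Z := by
    ext j p
    simp only [series_mul, series_add, Pi.add_apply, Toda.mul, add_mul]
    exact (wsummable_mul X Z j p).summable.tsum_add (wsummable_mul Y Z j p).summable
  zero_mul X := by
    ext j p
    simp [Toda.mul]
  mul_zero X := by
    ext j p
    simp [Toda.mul]
  mul_assoc X Y Z := by
    obtain ⟨d, hd⟩ := X.2
    obtain ⟨e, he⟩ := Y.2
    obtain ⟨f, hf⟩ := Z.2
    exact ext (mul_assoc_of_degreeLE v hd he hf)
  one_mul X := by
    ext j p
    rw [series_mul, series_one, one, monomial_mul]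
    simp
  mul_one X := by
    ext j p
    rw [series_mul, series_one, one, mul_monomial]
    simp

theorem npow_series (X : BoundedSeries A v) (m : ℕ) : npow v X.series m = (X ^ m).series := by
  induction m with
  | zero => rw [pow_zero, series_one]; rfl
  | succ m ih => rw [pow_succ, series_mul, ← ih]; rfl

theorem zpow_series (X : (BoundedSeries A v)ˣ) (j : ℤ) :
    zpow v (X : BoundedSeries A v).series (↑X⁻¹ : BoundedSeries A v).series j =
      (↑(X ^ j) : BoundedSeries A v).series := by
  unfold zpow
  split_ifs with h
  · rw [npow_series]
    obtain ⟨m, rfl⟩ := Int.eq_ofNat_of_zero_le h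
    simp
  · rw [npow_series]
    obtain ⟨m, hm⟩ := Int.eq_ofNat_of_zero_le (show 0 ≤ -j by omega)
    obtain rfl : j = -(m : ℤ) := by omega
    simp [zpow_neg]

end BoundedSeries

/-! ## The weight filtration on formal power series in the times -/

/-- The weight of a monomial in the times, where `t_{ja}` has weight `j`. -/
def weight {N : ℕ} : ((ℕ+ × Idx N) →₀ ℕ) →+ ℕ := Finsupp.weight fun x => (x.1 : ℕ)

/-- A monomial of weight u sees only the terms outside the step u + 1 of the filtration. In a family
tending to zero these are finite in number, so every coefficient is a finite sum. -/
instance TimeRing.weightFiltration (N : ℕ) : WeightFiltration (TimeRing N) where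
  fil w :=
    { carrier := {x | ∀ α, (weight α : ℤ) < w → MvPowerSeries.coeff α x = 0}
      zero_mem' := fun α _ => map_zero _
      add_mem' := fun hx hy α h => by rw [map_add, hx α h, hy α h, add_zero]
      smul_mem' := fun c x hx α h => by rw [map_smul, hx α h, smul_zero] }
  fil_nonpos w hw := by
    refine eq_top_iff.2 fun x _ α h => ?_
    omega
  fil_anti w w' h x hx α hα := hx α (hα.trans_le h)
  fil_mul := by
    classical
    intro a b x y hx hy α hα
    rw [MvPowerSeries.coeff_mul]
    refine Finset.sum_eq_zero fun q hq => ?_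
    rw [Finset.HasAntidiagonal.mem_antidiagonal] at hq
    have hw : weight q.1 + weight q.2 = weight α := by rw [← map_add, hq]
    rcases lt_or_ge (weight q.1 : ℤ) a with h | h
    · rw [hx _ h, zero_mul]
    · rw [hy _ (by omega), mul_zero]
  fil_closed w := by
    change IsClosed {x : TimeRing N | ∀ α, (weight α : ℤ) < w → MvPowerSeries.coeff α x = 0}
    simp only [Set.ofPred_forall]
    exact isClosed_iInter fun α => isClosed_iInter fun _ =>
      isClosed_eq (MvPowerSeries.WithPiTopology.continuous_coeff ℂ α) continuous_const
  summable_of_fil f hf := by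
    rw [MvPowerSeries.WithPiTopology.summable_iff_summable_coeff]
    intro α
    refine summable_of_hasFiniteSupport ((hf (weight α + 1)).subset fun i hi hc => hi ?_)
    exact hc α (by omega)

instance Mat.weightFiltration (N : ℕ) : WeightFiltration (Mat N) where
  fil w :=
    { carrier := {x | ∀ i j, x i j ∈ fil (A := TimeRing N) w}
      zero_mem' := fun i j => Submodule.zero_mem _
      add_mem' := fun hx hy i j => Submodule.add_mem _ (hx i j) (hy i j)
      smul_mem' := fun c x hx i j => Submodule.smul_mem _ c (hx i j) }
  fil_nonpos w hw := eq_top_iff.2 fun x _ i j => mem_fil_of_nonpos hw _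
  fil_anti w w' h x hx i j := fil_anti h (hx i j)
  fil_mul := by
    intro a b x y hx hy i j
    rw [Matrix.mul_apply]
    exact Submodule.sum_mem _ fun k _ => fil_mul (hx i k) (hy k j)
  fil_closed w := by
    change IsClosed {x : Mat N | ∀ i j, x i j ∈ fil (A := TimeRing N) w}
    simp only [Set.ofPred_forall]
    exact isClosed_iInter fun i => isClosed_iInter fun j =>
      (fil_closed w).preimage (continuous_id.matrix_elem i j)
  summable_of_fil f hf := by
    refine Pi.summable.2 fun i => Pi.summable.2 fun j => ?_
    refine summable_of_fil _ fun w => (hf w).subset fun q hq hc => hq (hc i j)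

theorem Mat.smul_mem_fil {N : ℕ} {w w' : ℤ} {c : TimeRing N} (hc : c ∈ fil (A := TimeRing N) w)
    {x : Mat N} (hx : x ∈ fil (A := Mat N) w') : c • x ∈ fil (A := Mat N) (w + w') := fun i j =>
  fil_mul hc (hx i j)

theorem Mat.tsum_apply {N : ℕ} {ι : Type*} {f : ι → Mat N} (hf : Summable f) (i j : Fin N) :
    (∑' x, f x) i j = ∑' x, f x i j := by
  have h₁ : (∑' x, f x) i = ∑' x, f x i := by
    exact _root_.tsum_apply hf
  rw [h₁]
  exact _root_.tsum_apply (Pi.summable.1 hf i)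

/-- This fixes the choice of weights: ∑ t_{ja} Θ^j acquires degree 0, and so does its exponential.
-/
theorem time_mem_fil {N : ℕ} (a : Idx N) (j : ℤ) : time a j ∈ fil (A := TimeRing N) j := by
  classical
  unfold time
  split_ifs with h
  · intro α hα
    rw [MvPowerSeries.coeff_X, if_neg]
    rintro rfl
    simp [weight, Finsupp.weight_single] at hα
  · exact Submodule.zero_mem _

/-! ## Series with constant scalar coefficients -/

section Constant

variable {P : Type*} [AddCommGroup P] {N : ℕ} {A : Type*} [Ring A] [Algebra ℂ A]
  [Algebra (TimeRing N) A] [IsScalarTower ℂ (TimeRing N) A]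

/-- The coefficients of a power series, extended by zero to negative indices. -/
def laurentCoeff (f : PowerSeries (TimeRing N)) (j : ℤ) : TimeRing N :=
  if 0 ≤ j then PowerSeries.coeff j.toNat f else 0

theorem laurentCoeff_neg_index (f : PowerSeries (TimeRing N)) {j : ℤ} (h : j < 0) :
    laurentCoeff f j = 0 := if_neg (by omega)

variable (P A) in
/-- The series in the shift given by a power series with scalar coefficients. -/
def ofPowerSeries (f : PowerSeries (TimeRing N)) : ShiftSeries P A :=
  fun j _ => laurentCoeff f j • (1 : A)

theorem boundedBelow_ofPowerSeries (f : PowerSeries (TimeRing N)) :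
    BoundedBelow (ofPowerSeries P A f) :=
  ⟨0, fun j hj p => by rw [ofPowerSeries, laurentCoeff_neg_index f hj, zero_smul]⟩

theorem ofPowerSeries_one : ofPowerSeries P A (1 : PowerSeries (TimeRing N)) = one := by
  funext j p
  simp only [ofPowerSeries, laurentCoeff, one, monomial, PowerSeries.coeff_one]
  split_ifs <;> first | omega | simp

theorem laurentCoeff_mul (f g : PowerSeries (TimeRing N)) (j : ℤ) :
    laurentCoeff (f * g) j =
      ∑ i ∈ Finset.Icc 0 j, laurentCoeff f i * laurentCoeff g (j - i) := by
  rcases lt_or_ge j 0 with hj | hj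
  · rw [laurentCoeff_neg_index _ hj, Finset.Icc_eq_empty (by omega), Finset.sum_empty]
  · obtain ⟨m, rfl⟩ := Int.eq_ofNat_of_zero_le hj
    simp only [laurentCoeff, if_pos hj, Int.toNat_natCast, PowerSeries.coeff_mul]
    refine Finset.sum_bij' (fun q _ => (q.1 : ℤ)) (fun i _ => (i.toNat, m - i.toNat)) ?_ ?_ ?_ ?_ ?_
    · rintro ⟨a, b⟩ h
      replace h : a + b = m := Finset.HasAntidiagonal.mem_antidiagonal.1 h
      simp only [Finset.mem_Icc] at *
      omega
    · intro i h
      rw [Finset.mem_Icc] at h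
      rw [Finset.HasAntidiagonal.mem_antidiagonal]
      dsimp only
      omega
    · rintro ⟨a, b⟩ h
      replace h : a + b = m := Finset.HasAntidiagonal.mem_antidiagonal.1 h
      simp only [Prod.mk.injEq, Int.toNat_natCast, true_and]
      omega
    · intro i h
      rw [Finset.mem_Icc] at h
      dsimp only
      omega
    · rintro ⟨a, b⟩ h
      replace h : a + b = m := Finset.HasAntidiagonal.mem_antidiagonal.1 h
      dsimp only
      rw [if_pos (by omega), if_pos (by omega)]
      rw [Int.toNat_natCast, show ((m : ℤ) - a).toNat = b by omega]

variable [TopologicalSpace A]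

theorem ofPowerSeries_mul (v : P) (f g : PowerSeries (TimeRing N)) :
    mul v (ofPowerSeries P A f) (ofPowerSeries P A g) = ofPowerSeries P A (f * g) := by
  funext j p
  have h : ∀ i ∉ Finset.Icc 0 j, laurentCoeff f i * laurentCoeff g (j - i) = 0 := by
    intro i hi
    rw [Finset.mem_Icc] at hi
    rcases lt_or_ge i 0 with h | h
    · rw [laurentCoeff_neg_index f h, zero_mul]
    · rw [laurentCoeff_neg_index g (by omega), mul_zero]
  simp only [mul, ofPowerSeries, smul_mul_smul_comm, mul_one]
  rw [tsum_eq_sum (s := Finset.Icc 0 j) fun i hi => by rw [h i hi, zero_smul],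
    laurentCoeff_mul, Finset.sum_smul]

theorem npow_ofPowerSeries (v : P) (f : PowerSeries (TimeRing N)) (m : ℕ) :
    npow v (ofPowerSeries P A f) m = ofPowerSeries P A (f ^ m) := by
  induction m with
  | zero => rw [pow_zero, ofPowerSeries_one]; rfl
  | succ m ih => rw [pow_succ, ← ofPowerSeries_mul v, ← ih]; rfl

/-- The exponential of a power series without constant term. -/
def expPowerSeries (f : PowerSeries (TimeRing N)) : PowerSeries (TimeRing N) :=
  (PowerSeries.exp ℂ).subst f

/-- Substitute f into exp(x) exp(-x) = 1; putting -f into exp is the same as putting f into exp(-x).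
-/
theorem expPowerSeries_mul_neg {f : PowerSeries (TimeRing N)}
    (hf : PowerSeries.constantCoeff f = 0) :
    expPowerSeries f * expPowerSeries (-f) = 1 := by
  have hs : PowerSeries.HasSubst f := PowerSeries.HasSubst.of_constantCoeff_zero' hf
  have hs' : PowerSeries.HasSubst (-f) :=
    PowerSeries.HasSubst.of_constantCoeff_zero' (by rw [map_neg, hf, neg_zero])
  have hneg : expPowerSeries (-f) =
      (PowerSeries.evalNegHom (PowerSeries.exp ℂ)).subst f := by
    ext1 n
    rw [expPowerSeries, PowerSeries.coeff_subst' hs', PowerSeries.coeff_subst' hs]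
    refine finsum_congr fun d => ?_
    rw [PowerSeries.evalNegHom, PowerSeries.coeff_rescale]
    rcases Nat.even_or_odd d with h | h <;> simp [h.neg_pow]
  rw [hneg, expPowerSeries, ← PowerSeries.subst_mul hs, PowerSeries.exp_mul_exp_neg_eq_one,
    ← PowerSeries.coe_substAlgHom hs, map_one]

/-- Since f^m has order at least m, only m ≤ n contributes to the n-th coefficient. The topological
sum and the formal substitution therefore reduce to the same finite sum. -/
theorem exp_ofPowerSeries (v : P) [T2Space A] {f : PowerSeries (TimeRing N)}
    (hf : PowerSeries.constantCoeff f = 0) :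
    exp v (ofPowerSeries P A f) = ofPowerSeries P A (expPowerSeries f) := by
  have hs : PowerSeries.HasSubst f := PowerSeries.HasSubst.of_constantCoeff_zero' hf
  funext j p
  simp only [exp, npow_ofPowerSeries, ofPowerSeries]
  rcases lt_or_ge j 0 with hj | hj
  · simp [laurentCoeff_neg_index _ hj]
  obtain ⟨n, rfl⟩ := Int.eq_ofNat_of_zero_le hj
  simp only [laurentCoeff, if_pos hj, Int.toNat_natCast]
  have hz : ∀ m ∉ Finset.range (n + 1), PowerSeries.coeff n (f ^ m) = 0 := by
    intro m hm
    rw [Finset.mem_range] at hm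
    exact PowerSeries.coeff_of_lt_order _ (lt_of_lt_of_le (by exact_mod_cast (by omega : n < m))
      (PowerSeries.le_order_pow_of_constantCoeff_eq_zero m hf))
  rw [tsum_eq_sum (s := Finset.range (n + 1)) fun m hm => by rw [hz m hm, zero_smul, smul_zero],
    expPowerSeries, PowerSeries.coeff_subst' hs,
    finsum_eq_sum_of_support_subset (s := Finset.range (n + 1)) _ fun m hm => by
      by_contra hc
      exact hm (by simp only; rw [hz m (by simpa using hc), smul_zero]),
    Finset.sum_smul]
  refine Finset.sum_congr rfl fun m _ => ?_
  rw [PowerSeries.coeff_exp, ← smul_assoc]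
  simp

end Constant

/-- The power series `∑_{j≥1} t_{ja} x^j`. -/
def timePowerSeries {N : ℕ} (a : Idx N) : PowerSeries (TimeRing N) :=
  PowerSeries.mk fun j => time a j

theorem constantCoeff_timePowerSeries {N : ℕ} (a : Idx N) :
    PowerSeries.constantCoeff (timePowerSeries a) = 0 := by
  rw [timePowerSeries, ← PowerSeries.coeff_zero_eq_constantCoeff_apply, PowerSeries.coeff_mk]
  simp [time]

theorem laurentCoeff_timePowerSeries {N : ℕ} (a : Idx N) (j : ℤ) :
    laurentCoeff (timePowerSeries a) j = time a j := by
  unfold laurentCoeff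
  split_ifs with h
  · rw [timePowerSeries, PowerSeries.coeff_mk, Int.toNat_of_nonneg h]
  · rw [time, dif_neg (by omega)]

/-- Algebras over the ring of formal power series in the times with a compatible filtration. -/
class FilteredTimeAlgebra (N : ℕ) (A : Type*) [Ring A] [Algebra ℂ A] [TopologicalSpace A]
    [WeightFiltration A] [Algebra (TimeRing N) A] : Prop where
  smul_mem_fil : ∀ {w w' : ℤ} {c : TimeRing N} {x : A}, c ∈ fil (A := TimeRing N) w →
    x ∈ fil (A := A) w' → c • x ∈ fil (A := A) (w + w')

instance (N : ℕ) : FilteredTimeAlgebra N (TimeRing N) := ⟨fun hc hx => fil_mul hc hx⟩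

instance (N : ℕ) : FilteredTimeAlgebra N (Mat N) := ⟨fun hc hx => Mat.smul_mem_fil hc hx⟩

section Exp

variable {P A : Type*} [AddCommGroup P] [Ring A] [Algebra ℂ A] [TopologicalSpace A]
  [WeightFiltration A]

theorem DegreeLE.npow {X : ShiftSeries P A} (hX : DegreeLE 0 X) (v : P) (m : ℕ) :
    DegreeLE 0 (npow v X m) := by
  induction m with
  | zero => exact degreeLE_monomial 0 _
  | succ m ih => exact ih.mul hX v

theorem DegreeLE.exp {X : ShiftSeries P A} (hX : DegreeLE 0 X) (v : P) :
    DegreeLE 0 (exp v X) := fun j p =>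
  tsum_mem_fil fun m => Submodule.smul_mem _ _ (hX.npow v m j p)

theorem DegreeLE.neg {d : ℤ} {X : ShiftSeries P A} (hX : DegreeLE d X) : DegreeLE d (-X) :=
  fun j p => Submodule.neg_mem _ (hX j p)

end Exp

/-! ### Shifts, multiplication operators and exponentials in the ring of bounded series -/

namespace BoundedSeries

section Shift

variable {P A : Type*} [AddCommGroup P] [Ring A] [Algebra ℂ A] [TopologicalSpace A]
  [WeightFiltration A] [IsTopologicalRing A] [T2Space A]

theorem monomial_mul_monomial (v : P) (j k : ℤ) (f g : P → A) :
    Toda.mul v (monomial j f) (monomial k g) = monomial (j + k) fun p => f p * g (p + j • v) := by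
  funext l p
  rw [monomial_mul]
  unfold monomial
  by_cases h : l - j = k
  · rw [if_pos h, if_pos (by omega)]
  · rw [if_neg h, if_neg (by omega), mul_zero]

variable (A) in
/-- The shift as an invertible series. -/
def shift (v : P) : (BoundedSeries A v)ˣ where
  val := mk (monomial 1 fun _ => 1) (degreeLE_monomial 1 _)
  inv := mk (monomial (-1) fun _ => 1) (degreeLE_monomial (-1) _)
  val_inv := by
    ext1
    simp only [series_mul, series_mk, monomial_mul_monomial, mul_one]
    rfl
  inv_val := by
    ext1
    simp only [series_mul, series_mk, monomial_mul_monomial, mul_one]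
    rfl

theorem series_shift_zpow (v : P) (j : ℤ) :
    (↑(shift A v ^ j) : BoundedSeries A v).series = monomial j fun _ => 1 := by
  induction j with
  | zero => rfl
  | succ m ih =>
    rw [zpow_add_one, Units.val_mul, series_mul, ih]
    exact (monomial_mul_monomial v _ _ _ _).trans (by simp)
  | pred m ih =>
    rw [zpow_sub_one, Units.val_mul, series_mul, ih]
    exact (monomial_mul_monomial v _ _ _ _).trans (by simp [sub_eq_add_neg])

/-- Multiplication by a function, as a series. -/
def const (v : P) (f : P → A) : BoundedSeries A v := mk (monomial 0 f) (degreeLE_monomial 0 f)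

theorem const_mul (v : P) (f g : P → A) : const v f * const v g = const v (f * g) := by
  ext1
  simp only [series_mul, const, series_mk, monomial_mul_monomial]
  simp
  rfl

theorem const_pow (v : P) (f : P → A) (i : ℕ) : const v f ^ i = const v (f ^ i) := by
  induction i with
  | zero => rw [pow_zero, pow_zero]; rfl
  | succ i ih => rw [pow_succ, ih, const_mul, pow_succ]

theorem series_mul_const_mul_shift {v : P} (X : BoundedSeries A v) (f : P → A) (j l : ℤ) (p : P) :
    (X * const v f * ↑(shift A v ^ j)).series l p =
      X.series (l - j) p * f (p + (l - j) • v) := by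
  rw [series_mul, series_shift_zpow, mul_monomial, series_mul, const, series_mk, mul_monomial]
  simp

theorem const_intCast (v : P) (k : ℤ) : const v (fun _ => (k : A)) = k := by
  have h : ∀ m : ℕ, const v (fun _ => (m : A)) = m := by
    intro m
    induction m with
    | zero => ext j p; simp [const, monomial]
    | succ m ih =>
      rw [Nat.cast_succ (R := BoundedSeries A v), ← ih]
      ext j p
      simp only [const, Nat.cast_succ, series_mk, monomial, series_add, series_one, one, Pi.add_apply]
      split_ifs <;> simp
  obtain ⟨m, rfl | rfl⟩ := Int.eq_nat_or_neg k
  · simpa using h m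
  · rw [Int.cast_neg (R := BoundedSeries A v), Int.cast_natCast (R := BoundedSeries A v), ← h m]
    ext j p
    simp only [const, Int.cast_neg, Int.cast_natCast, series_mk, monomial, series_neg, Pi.neg_apply]
    split_ifs <;> simp

end Shift

section Times

variable {P : Type*} [AddCommGroup P] {N : ℕ} {A : Type*} [Ring A] [Algebra ℂ A]
  [Algebra (TimeRing N) A] [IsScalarTower ℂ (TimeRing N) A] [TopologicalSpace A]
  [WeightFiltration A] [FilteredTimeAlgebra N A]

theorem degreeLE_timeSeries (a : Idx N) :
    DegreeLE 0 (fun j _ => time a j • 1 : ShiftSeries P A) := by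
  intro j p
  have := FilteredTimeAlgebra.smul_mem_fil (A := A) (time_mem_fil a j)
    (mem_fil_of_nonpos le_rfl 1)
  simpa using this

theorem ofPowerSeries_timePowerSeries (a : Idx N) :
    ofPowerSeries P A (timePowerSeries a) = fun j _ => time a j • 1 := by
  funext j p
  rw [ofPowerSeries, laurentCoeff_timePowerSeries]

theorem ofPowerSeries_neg (f : PowerSeries (TimeRing N)) :
    ofPowerSeries P A (-f) = -ofPowerSeries P A f := by
  funext j p
  simp only [ofPowerSeries, laurentCoeff, Pi.neg_apply, map_neg]
  split_ifs <;> simp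

variable [IsTopologicalRing A] [T2Space A]

theorem degreeLE_expPowerSeries (a : Idx N) :
    DegreeLE 0 (ofPowerSeries P A (expPowerSeries (timePowerSeries a))) := by
  -- The direction does not affect series with constant coefficients; 0 is an arbitrary choice.
  rw [← exp_ofPowerSeries 0 (constantCoeff_timePowerSeries a), ofPowerSeries_timePowerSeries]
  exact (degreeLE_timeSeries a).exp 0

theorem degreeLE_expPowerSeries_neg (a : Idx N) :
    DegreeLE 0 (ofPowerSeries P A (expPowerSeries (-timePowerSeries a))) := by
  rw [← exp_ofPowerSeries 0 (by rw [map_neg, constantCoeff_timePowerSeries, neg_zero]),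
    ofPowerSeries_neg, ofPowerSeries_timePowerSeries]
  exact (degreeLE_timeSeries a).neg.exp 0

variable (A) in
/-- The invertible series `exp(∑_{j≥1} t_{ja} Θ^j)`. -/
def expTime (v : P) (a : Idx N) : (BoundedSeries A v)ˣ where
  val := mk _ (degreeLE_expPowerSeries a)
  inv := mk _ (degreeLE_expPowerSeries_neg a)
  val_inv := by
    ext1
    simp only [series_mul, series_mk, ofPowerSeries_mul, series_one]
    rw [expPowerSeries_mul_neg (constantCoeff_timePowerSeries a), ofPowerSeries_one]
  inv_val := by
    ext1
    simp only [series_mul, series_mk, ofPowerSeries_mul, series_one]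
    rw [mul_comm, expPowerSeries_mul_neg (constantCoeff_timePowerSeries a), ofPowerSeries_one]

theorem series_expTime (v : P) (a : Idx N) :
    (expTime A v a : BoundedSeries A v).series = exp v fun j _ => time a j • 1 := by
  rw [← ofPowerSeries_timePowerSeries, exp_ofPowerSeries v (constantCoeff_timePowerSeries a)]
  rfl

theorem series_expTime_inv (v : P) (a : Idx N) :
    (↑(expTime A v a)⁻¹ : BoundedSeries A v).series = exp v (-fun j _ => time a j • 1) := by
  rw [← ofPowerSeries_timePowerSeries, ← ofPowerSeries_neg,
    exp_ofPowerSeries v (by rw [map_neg, constantCoeff_timePowerSeries, neg_zero])]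
  rfl

/-- The coefficients of `exp(∑_{j≥1} t_{ja} x^j)`. -/
def expCoeff (a : Idx N) : ℤ → TimeRing N := laurentCoeff (expPowerSeries (timePowerSeries a))

/-- The coefficients of `exp(-∑_{j≥1} t_{ja} x^j)`. -/
def expNegCoeff (a : Idx N) : ℤ → TimeRing N :=
  laurentCoeff (expPowerSeries (-timePowerSeries a))

theorem mul_ofPowerSeries (v : P) (X : ShiftSeries P A) (f : PowerSeries (TimeRing N)) (l : ℤ)
    (p : P) : Toda.mul v X (ofPowerSeries P A f) l p =
      ∑' i : ℤ, laurentCoeff f i • X (l - i) p := by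
  unfold Toda.mul ofPowerSeries
  rw [← (Equiv.subLeft l).tsum_eq]
  refine tsum_congr fun i => ?_
  simp

theorem series_mul_expTime {v : P} (X : BoundedSeries A v) (a : Idx N) (l : ℤ) (p : P) :
    (X * ↑(expTime A v a)).series l p = ∑' i : ℤ, expCoeff a i • X.series (l - i) p :=
  mul_ofPowerSeries v X.series _ l p

theorem series_mul_expTime_inv {v : P} (X : BoundedSeries A v) (a : Idx N) (l : ℤ) (p : P) :
    (X * ↑(expTime A v a)⁻¹).series l p = ∑' i : ℤ, expNegCoeff a i • X.series (l - i) p :=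
  mul_ofPowerSeries v X.series _ l p

theorem commute_ofPowerSeries_monomial (v : P) (f : PowerSeries (TimeRing N)) (j : ℤ) (c : A) :
    Toda.mul v (ofPowerSeries P A f) (monomial j fun _ => c) =
      Toda.mul v (monomial j fun _ => c) (ofPowerSeries P A f) := by
  funext l p
  rw [monomial_mul, mul_monomial]
  simp [ofPowerSeries]

theorem commute_expTime_shift (v : P) (a : Idx N) : Commute (expTime A v a) (shift A v) := by
  refine Units.ext (ext ?_)
  exact commute_ofPowerSeries_monomial v _ 1 1

end Times

end BoundedSeries

/-! ## Inverses of lower triangular series -/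

section LowerInverse

variable {P A : Type*} [AddCommGroup P] [CommRing A]

/-- The coefficients of the right inverse of `X_0 + X_{-1} Θ⁻¹ + ⋯`. -/
def lowerInvCoeff (v : P) (X : ShiftSeries P A) (m : ℕ) (p : P) : A :=
  Ring.inverse (X 0 p) * ((if m = 0 then 1 else 0) -
    ∑ i : Fin m, X (-(i + 1 : ℤ)) p * lowerInvCoeff v X (m - 1 - i) (p + (-(i + 1 : ℤ)) • v))
termination_by m
decreasing_by have := i.2; omega

/-- In the coefficient of Θ^{-m} of the product, the term i = 0 contains the newest unknown times
the invertible leading coefficient. The recursion solves for it in terms of the earlier ones. -/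
theorem mul_lowerInvCoeff [TopologicalSpace A] (v : P) {X : ShiftSeries P A}
    (hX : ∀ j, 0 < j → ∀ p, X j p = 0) (hu : ∀ p, IsUnit (X 0 p)) :
    mul v X (fun j p => if j ≤ 0 then lowerInvCoeff v X (-j).toNat p else 0) = one := by
  funext l p
  unfold mul
  rcases lt_or_ge 0 l with hl | hl
  · have : ∀ i : ℤ, X i p * (if l - i ≤ 0 then
        lowerInvCoeff v X (-(l - i)).toNat (p + i • v) else 0) = 0 := by
      intro i
      rcases lt_or_ge 0 i with hi | hi
      · rw [hX i hi, zero_mul]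
      · rw [if_neg (by omega), mul_zero]
    simp only [this, tsum_zero, one, monomial]
    rw [if_neg (by omega)]
  obtain ⟨m, hm⟩ := Int.eq_ofNat_of_zero_le (show 0 ≤ -l by omega)
  obtain rfl : l = -(m : ℤ) := by omega
  obtain ⟨e, he⟩ : ∃ e : ℕ ↪ ℤ, ∀ i : ℕ, e i = -(i : ℤ) :=
    ⟨⟨fun i => -(i : ℤ), fun i j h => by simpa using h⟩, fun _ => rfl⟩
  rw [tsum_eq_sum (s := (Finset.range (m + 1)).map e), Finset.sum_map, Finset.sum_range_succ']
  · have h0 : X 0 p * lowerInvCoeff v X m p = (if m = 0 then 1 else 0) -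
        ∑ i : Fin m, X (-(i + 1 : ℤ)) p *
          lowerInvCoeff v X (m - 1 - i) (p + (-(i + 1 : ℤ)) • v) := by
      rw [lowerInvCoeff, ← mul_assoc, Ring.mul_inverse_cancel _ (hu p), one_mul]
    rw [← Fin.sum_univ_eq_sum_range (fun i => X (e (i + 1)) p *
      (if -(m : ℤ) - e (i + 1) ≤ 0 then
        lowerInvCoeff v X (-(-(m : ℤ) - e (i + 1))).toNat (p + e (i + 1) • v) else 0)) m]
    have h1 : X (e 0) p * (if -(m : ℤ) - e 0 ≤ 0 then
        lowerInvCoeff v X (-(-(m : ℤ) - e 0)).toNat (p + e 0 • v) else 0) =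
        X 0 p * lowerInvCoeff v X m p := by
      simp [he]
    rw [h1, h0, add_comm, sub_add_eq_add_sub, sub_eq_iff_eq_add]
    congr 1
    · simp [one, monomial]
    · refine Finset.sum_congr rfl fun i _ => ?_
      have := i.2
      rw [he, Nat.cast_succ, if_pos (by omega)]
      congr 2
      omega
  · intro i hi
    rcases lt_or_ge 0 i with h | h
    · rw [hX i h, zero_mul]
    · dsimp only
      rw [if_neg, mul_zero]
      intro hc
      apply hi
      rw [Finset.mem_map]
      refine ⟨(-i).toNat, ?_, ?_⟩
      · rw [Finset.mem_range]; omega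
      · rw [he]; omega

theorem exists_lower_right_inverse [TopologicalSpace A] (v : P) {X : ShiftSeries P A}
    (hX : ∀ j, 0 < j → ∀ p, X j p = 0) (hu : ∀ p, IsUnit (X 0 p)) :
    ∃ Y : ShiftSeries P A, (∀ j, 0 < j → ∀ p, Y j p = 0) ∧ (∀ p, IsUnit (Y 0 p)) ∧
      mul v X Y = one := by
  refine ⟨_, fun j hj p => if_neg (by omega), fun p => ?_, mul_lowerInvCoeff v hX hu⟩
  rw [if_pos le_rfl, neg_zero, Int.toNat_zero, lowerInvCoeff]
  simpa using hu p

/-- The recursion gives a right inverse Y of X, and again a right inverse Z of Y, since the leading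
coefficient of Y is a unit. Associativity forces X = Z, so Y is two-sided and the choice in
`lowerInv` is not the default 0. -/
theorem lowerInv_spec [Algebra ℂ A] [TopologicalSpace A] [WeightFiltration A]
    [IsTopologicalRing A] [T2Space A] (v : P) {X : ShiftSeries P A}
    (hX : ∀ j, 0 < j → ∀ p, X j p = 0) (hu : ∀ p, IsUnit (X 0 p)) :
    (∀ j, 0 < j → ∀ p, lowerInv v X j p = 0) ∧ mul v X (lowerInv v X) = one ∧
      mul v (lowerInv v X) X = one := by
  have h : ∃ Y : ShiftSeries P A, (∀ j, 0 < j → ∀ p, Y j p = 0) ∧ mul v X Y = one ∧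
      mul v Y X = one := by
    obtain ⟨Y, hY, huY, hXY⟩ := exists_lower_right_inverse v hX hu
    obtain ⟨Z, hZ, -, hYZ⟩ := exists_lower_right_inverse v hY huY
    refine ⟨Y, hY, hXY, ?_⟩
    let x : BoundedSeries A v := .mk X (degreeLE_of_lower hX)
    let y : BoundedSeries A v := .mk Y (degreeLE_of_lower hY)
    let z : BoundedSeries A v := .mk Z (degreeLE_of_lower hZ)
    have hxy : x * y = 1 := BoundedSeries.ext hXY
    have hyz : y * z = 1 := BoundedSeries.ext hYZ
    have hx : x = z := left_inv_eq_right_inv hxy hyz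
    have : y * x = 1 := by rw [hx, hyz]
    exact congrArg BoundedSeries.series this
  unfold lowerInv
  rw [dif_pos h]
  exact h.choose_spec

end LowerInverse

/-! ## Insertion of operators in formal series -/

section Eval

variable {P A : Type*} [AddCommGroup P] [Ring A] [Algebra ℂ A] [TopologicalSpace A]
  [WeightFiltration A] {F : ℕ → ℤ → ℂ} {B : ℕ → ℤ → ShiftSeries P A} {d : ℤ}

/-- The powers j are bounded above by admissibility and below modulo weight, because the degree of
`B i j` falls with j uniformly in i. Each remaining j admits finitely many i. -/
theorem Admissible.wsummable_sumTerm (hF : Admissible F) (hB : ∀ i j, DegreeLE (j + d) (B i j))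
    (l : ℤ) (p : P) : WSummable (sumTerm F B l p) := by
  intro w
  obtain ⟨⟨r, hr⟩, hf⟩ := hF
  refine ((Set.finite_Icc (l - d - w) r).biUnion
    (t := fun j => (fun i => (i, j)) '' {i | F i j ≠ 0}) fun j _ => (hf j).image _).subset ?_
  rintro ⟨i, j⟩ h
  have h0 : F i j ≠ 0 := by
    rintro h0
    apply h
    simp [sumTerm, h0]
  simp only [Set.mem_iUnion]
  refine ⟨j, ⟨?_, ?_⟩, i, h0, rfl⟩
  · by_contra hc
    exact h (Submodule.smul_mem _ _ (mem_fil_of_le (by omega) (hB i j l p)))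
  · by_contra hc
    exact h0 (hr i j (by omega))

theorem degreeLE_sumTerm {r : ℤ} (hr : ∀ i j, r < j → F i j = 0)
    (hB : ∀ i j, DegreeLE (j + d) (B i j)) (q : ℕ × ℤ) :
    DegreeLE (r + d) fun l p => sumTerm F B l p q := by
  intro l p
  simp only [sumTerm]
  by_cases h : r < q.2
  · rw [hr _ _ h, zero_smul]
    exact Submodule.zero_mem _
  · exact Submodule.smul_mem _ _ (mem_fil_of_le (by omega) (hB q.1 q.2 l p))

theorem degreeLE_evalSeries {r : ℤ} (hr : ∀ i j, r < j → F i j = 0)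
    (hB : ∀ i j, DegreeLE (j + d) (B i j)) : DegreeLE (r + d) (evalSeries F B) := fun l p =>
  tsum_mem_fil fun q => degreeLE_sumTerm hr hB q l p

variable [IsTopologicalRing A] [T2Space A]

theorem smul_mul_series (v : P) (c : ℂ) {X Y : ShiftSeries P A} {d e : ℤ} (hX : DegreeLE d X)
    (hY : DegreeLE e Y) (l : ℤ) (p : P) :
    mul v (fun l p => c • X l p) Y l p = c • mul v X Y l p := by
  simp only [mul, Algebra.smul_def]
  rw [← (hX.wsummable_mul hY l p _).summable.tsum_mul_left]
  simp only [mul_assoc]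

theorem evalSeries_mul (v : P) (hF : Admissible F) (hB : ∀ i j, DegreeLE (j + d) (B i j))
    {Y : ShiftSeries P A} {e : ℤ} (hY : DegreeLE e Y) (l : ℤ) (p : P) :
    mul v (evalSeries F B) Y l p = ∑' q : ℕ × ℤ, F q.1 q.2 • mul v (B q.1 q.2) Y l p := by
  obtain ⟨r, hr⟩ := hF.1
  have := tsum_mul_series v (fun q l p => sumTerm F B l p q) (degreeLE_sumTerm hr hB)
    (hF.wsummable_sumTerm hB) hY l p
  refine this.trans (tsum_congr fun q => ?_)
  exact smul_mul_series v _ (hB q.1 q.2) hY l p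

end Eval

/-! ## Scalar operators -/

namespace Factorization

variable {N : ℕ} [NeZero N] {𝔤 : LaurentAlgebra N} (D : Factorization 𝔤)

theorem K_of_pos (a : Idx N) (n : ℤ) (j : ℤ) (hj : 0 < j) (s : Charge N) : D.K a n j s = 0 :=
  if_neg (by omega)

theorem S_zero (s : Charge N) (n : ℤ) : (D.S s : 𝔤.Elem).series 0 n = 1 :=
  (D.S_mem s _ (Or.inl rfl)).1 n

theorem K_inl_zero_zero (n : ℤ) (s : Charge N) : D.K (Sum.inl 0) n 0 s = 1 := by
  simp [K, S_zero]

variable {D}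

theorem Nondegenerate.isUnit_K (hD : D.Nondegenerate) (a : Idx N) (n : ℤ) (s : Charge N) :
    IsUnit (D.K a n 0 s) := by
  rcases a with k | k
  · by_cases hk : k = 0
    · subst hk
      rw [K_inl_zero_zero]
      exact isUnit_one
    · simpa [K, hk] using (hD s n).1 k hk
  · simpa [K] using (hD s n).2 k

/-- The scalar operator `K_a` as an invertible series. -/
def dressingK (hD : D.Nondegenerate) (v : Charge N) (a : Idx N) (n : ℤ) :
    (BoundedSeries (TimeRing N) v)ˣ where
  val := .mk (D.K a n) (degreeLE_of_lower (D.K_of_pos a n))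
  inv := .mk (lowerInv v (D.K a n))
    (degreeLE_of_lower (lowerInv_spec v (D.K_of_pos a n) (hD.isUnit_K a n)).1)
  val_inv := BoundedSeries.ext (lowerInv_spec v (D.K_of_pos a n) (hD.isUnit_K a n)).2.1
  inv_val := BoundedSeries.ext (lowerInv_spec v (D.K_of_pos a n) (hD.isUnit_K a n)).2.2

/-- The scalar operator `W_a` as an invertible series. -/
def dressingW (hD : D.Nondegenerate) (v : Charge N) (a : Idx N) (n : ℤ) :
    (BoundedSeries (TimeRing N) v)ˣ :=
  dressingK hD v a n * BoundedSeries.expTime (TimeRing N) v a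

theorem timeSeries_eq (a : Idx N) : timeSeries a = fun j _ => time a j • (1 : TimeRing N) := by
  funext j p
  simp [timeSeries]

theorem series_dressingW (hD : D.Nondegenerate) (v : Charge N) (a : Idx N)
    (n : ℤ) :
    (dressingW hD v a n : BoundedSeries (TimeRing N) v).series = D.scalarW v a n := by
  rw [dressingW, Units.val_mul, BoundedSeries.series_mul, BoundedSeries.series_expTime,
    scalarW, timeSeries_eq]
  rfl

theorem series_dressingW_inv (hD : D.Nondegenerate) (v : Charge N) (a : Idx N)
    (n : ℤ) :
    (↑(dressingW hD v a n)⁻¹ : BoundedSeries (TimeRing N) v).series = D.scalarWinv v a n := by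
  rw [dressingW, mul_inv_rev, Units.val_mul, BoundedSeries.series_mul,
    BoundedSeries.series_expTime_inv, scalarWinv, timeSeries_eq]
  rfl

/-- The exponential of the times commutes with the shift, so dressing by K_a and by W_a gives the
same Lax operator. -/
theorem conj_shift_eq (hD : D.Nondegenerate) (v : Charge N) (a : Idx N)
    (n : ℤ) :
    dressingK hD v a n * BoundedSeries.shift (TimeRing N) v * (dressingK hD v a n)⁻¹ =
      dressingW hD v a n * BoundedSeries.shift (TimeRing N) v * (dressingW hD v a n)⁻¹ := by
  have h := (BoundedSeries.commute_expTime_shift (A := TimeRing N) v a).eq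
  rw [dressingW, mul_inv_rev, mul_assoc (dressingK hD v a n) _ (BoundedSeries.shift _ v), h]
  group

/-- The eigenvalue function of the scalar Orlov--Schulman operator before dressing. -/
def number (a : Idx N) (n : ℤ) (s : Charge N) : TimeRing N :=
  ((n - ν a + sg a * s.1 a : ℤ) : TimeRing N)

/-- The integer n - ν_a is central and can be drawn into the conjugation by W_a. -/
theorem scalarM_eq (hD : D.Nondegenerate) (v : Charge N) (a : Idx N)
    (n : ℤ) : D.scalarM v a n =
    (dressingW hD v a n * BoundedSeries.const v (number a n) *
      ↑(dressingW hD v a n)⁻¹ : BoundedSeries (TimeRing N) v).series := by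
  have h1 : BoundedSeries.const v (number a n) = ((n - ν a : ℤ) : BoundedSeries (TimeRing N) v) +
      sg a • BoundedSeries.const v fun s => ((s.1 a : ℤ) : TimeRing N) := by
    rw [zsmul_eq_mul, ← BoundedSeries.const_intCast, ← BoundedSeries.const_intCast,
      BoundedSeries.const_mul]
    ext1
    funext j s
    simp only [BoundedSeries.const, BoundedSeries.series_mk, BoundedSeries.series_add, monomial,
      Pi.add_apply, number]
    split_ifs <;> simp
  rw [h1, mul_add, add_mul, mul_smul_comm, smul_mul_assoc,
    (Int.cast_commute _ (dressingW hD v a n : BoundedSeries (TimeRing N) v)).symm.eq,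
    Units.mul_inv_cancel_right, ← BoundedSeries.const_intCast]
  rw [scalarM, ← series_dressingW hD, ← series_dressingW_inv hD]
  rfl

/-- Both operators are conjugates by the same W_a, so the inner factors cancel. This bounds the
degree by j independently of i, and makes the action on W_a explicit. -/
theorem scalarB_eq (hD : D.Nondegenerate) (v : Charge N) (a : Idx N)
    (n : ℤ) (i : ℕ) (j : ℤ) : D.scalarB v a n i j =
    (dressingW hD v a n * BoundedSeries.const v (number a n ^ i) *
      ↑(BoundedSeries.shift (TimeRing N) v ^ j) *
      ↑(dressingW hD v a n)⁻¹ : BoundedSeries (TimeRing N) v).series := by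
  have hL : D.scalarL v a n = (↑(dressingW hD v a n * BoundedSeries.shift (TimeRing N) v *
      (dressingW hD v a n)⁻¹) : BoundedSeries (TimeRing N) v).series := by
    rw [← conj_shift_eq]
    rfl
  have hL' : D.scalarLinv v a n = (↑(dressingW hD v a n * BoundedSeries.shift (TimeRing N) v *
      (dressingW hD v a n)⁻¹)⁻¹ : BoundedSeries (TimeRing N) v).series := by
    rw [← conj_shift_eq, mul_inv_rev, mul_inv_rev, inv_inv, ← mul_assoc]
    rfl
  have hconj : ∀ x : BoundedSeries (TimeRing N) v,
      (dressingW hD v a n * x * ↑(dressingW hD v a n)⁻¹ : BoundedSeries (TimeRing N) v) ^ i =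
        dressingW hD v a n * x ^ i * ↑(dressingW hD v a n)⁻¹ := fun x =>
    Units.conj_pow _ x i
  rw [scalarB, scalarM_eq hD, BoundedSeries.npow_series, hL, hL', BoundedSeries.zpow_series,
    ← BoundedSeries.series_mul, hconj, BoundedSeries.const_pow, conj_zpow]
  congr 1
  simp only [Units.val_mul, mul_assoc, Units.inv_mul_cancel_left]

theorem degreeLE_scalarW (v : Charge N) (a : Idx N) (n : ℤ) : DegreeLE 0 (D.scalarW v a n) := by
  rw [scalarW, timeSeries_eq]
  simpa using (degreeLE_of_lower (D.K_of_pos a n)).mul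
    ((BoundedSeries.degreeLE_timeSeries a).exp v) v

theorem degreeLE_scalarWinv (hD : D.Nondegenerate) (v : Charge N) (a : Idx N)
    (n : ℤ) : DegreeLE 0 (D.scalarWinv v a n) := by
  rw [scalarWinv, timeSeries_eq]
  simpa using ((BoundedSeries.degreeLE_timeSeries a).neg.exp v).mul
    (degreeLE_of_lower (lowerInv_spec v (D.K_of_pos a n) (hD.isUnit_K a n)).1) v

theorem degreeLE_scalarB (hD : D.Nondegenerate) (v : Charge N) (a : Idx N)
    (n : ℤ) (i : ℕ) (j : ℤ) : DegreeLE (j + 0) (D.scalarB v a n i j) := by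
  rw [scalarB_eq hD]
  simp only [BoundedSeries.series_mul, series_dressingW, series_dressingW_inv,
    BoundedSeries.series_shift_zpow, BoundedSeries.const, BoundedSeries.series_mk]
  simpa using (((degreeLE_scalarW v a n).mul (degreeLE_monomial 0 _) v).mul
    (degreeLE_monomial j _) v).mul (degreeLE_scalarWinv hD v a n) v

theorem wsummable_scalarF (hD : D.Nondegenerate) (v : Charge N) (a : Idx N)
    (n : ℤ) {F : Idx N → ℕ → ℤ → ℂ} (hF : ∀ a, Admissible (F a)) (l : ℤ)
    (s : Charge N) : WSummable (sumTerm (F a) (D.scalarB v a n) l s) :=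
  (hF a).wsummable_sumTerm (degreeLE_scalarB hD v a n) l s

theorem degreeLE_scalarF (hD : D.Nondegenerate) (v : Charge N) (n : ℤ)
    {F : Idx N → ℕ → ℤ → ℂ} {a : Idx N} {r : ℤ}
    (hr : ∀ i j, r < j → F a i j = 0) : DegreeLE r (D.scalarF v F a n) := by
  have := degreeLE_evalSeries hr (degreeLE_scalarB hD v a n)
  rwa [add_zero] at this

/-- The action of `F_a(𝓜_a, 𝓛_a)` on the dressing operator. -/
theorem scalarF_mul_scalarW (hD : D.Nondegenerate) (v : Charge N) (a : Idx N)
    (n : ℤ) {F : Idx N → ℕ → ℤ → ℂ} (hF : ∀ a, Admissible (F a)) (l : ℤ)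
    (s : Charge N) : mul v (D.scalarF v F a n) (D.scalarW v a n) l s =
      ∑' q : ℕ × ℤ, F a q.1 q.2 •
        (D.scalarW v a n (l - q.2) s * number a n (s + (l - q.2) • v) ^ q.1) := by
  rw [scalarF, evalSeries_mul v (hF a) (degreeLE_scalarB hD v a n) (degreeLE_scalarW v a n)]
  refine tsum_congr fun q => ?_
  congr 1
  rw [scalarB_eq hD, ← series_dressingW hD, ← BoundedSeries.series_mul, Units.inv_mul_cancel_right,
    BoundedSeries.series_mul_const_mul_shift]
  rfl

end Factorization

/-! ## Diagonal series -/

namespace BoundedSeries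

variable {N : ℕ} {v : ℤ}

/-- `E_kk Θ^j`. -/
def single (v : ℤ) (k : Fin N) (j : ℤ) : BoundedSeries (Mat N) v :=
  mk (EΛ k j) (degreeLE_monomial j _)

theorem series_single (k : Fin N) (j : ℤ) : (single v k j).series = EΛ k j := rfl

theorem single_mul_single (k l : Fin N) (i j : ℤ) :
    single v k i * single v l j = if k = l then single v k (i + j) else 0 := by
  ext1
  rw [series_mul, series_single, series_single, EΛ, EΛ, monomial_mul_monomial]
  split_ifs with h
  · subst h
    simp [series_single, EΛ]
  · rw [Matrix.single_mul_single_of_ne _ _ _ _ h]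
    funext j p
    simp [monomial]

theorem sum_single_zero : ∑ k : Fin N, single v k 0 = 1 := by
  ext1
  funext j p
  simp only [series_sum, series_single, EΛ, monomial, Finset.sum_apply, series_one, one]
  split_ifs
  · ext a b : 1
    rw [Matrix.sum_apply]
    rw [Finset.sum_eq_single a (fun k _ hk => Matrix.single_apply_of_row_ne hk _ _ _) (by simp)]
    by_cases h : a = b
    · subst h; simp
    · rw [Matrix.single_apply_of_col_ne _ _ h, Matrix.one_apply_ne h]
  · simp

theorem commute_expTime_single (a : Idx N) (k : Fin N) (j : ℤ) :
    Commute (expTime (Mat N) v a : BoundedSeries (Mat N) v) (single v k j) :=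
  ext (commute_ofPowerSeries_monomial v _ j _)

/-- The series `∑_k E_kk Θ^{c_k} x_k`. -/
def diag (c : Fin N → ℤ) (x : Fin N → BoundedSeries (Mat N) v) : BoundedSeries (Mat N) v :=
  ∑ k, single v k (c k) * x k

theorem diag_mul_diag (c c' : Fin N → ℤ) {x : Fin N → BoundedSeries (Mat N) v}
    (y : Fin N → BoundedSeries (Mat N) v) (hx : ∀ k l j, Commute (x k) (single v l j)) :
    diag c x * diag c' y = diag (c + c') (x * y) := by
  rw [diag, diag, diag, Finset.sum_mul]
  refine Finset.sum_congr rfl fun k _ => ?_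
  rw [Finset.mul_sum]
  have : ∀ l, single v k (c k) * x k * (single v l (c' l) * y l) =
      single v k (c k) * single v l (c' l) * (x k * y l) := by
    intro l
    rw [mul_assoc, ← mul_assoc (x k), (hx k l _).eq]
    simp only [mul_assoc]
  simp only [this, single_mul_single]
  rw [Finset.sum_eq_single k]
  · simp
  · intro l _ hl
    rw [if_neg (Ne.symm hl), zero_mul]
  · simp

theorem diag_zero_one : diag (v := v) (0 : Fin N → ℤ) 1 = 1 := by
  rw [diag, ← sum_single_zero]
  exact Finset.sum_congr rfl fun k _ => mul_one _

theorem series_mul_single_apply (X : BoundedSeries (Mat N) v) (k : Fin N) (c l : ℤ) (p : ℤ)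
    (i₀ k₀ : Fin N) : (X * single v k c).series l p i₀ k₀ =
      if k = k₀ then X.series (l - c) p i₀ k₀ else 0 := by
  rw [series_mul, series_single, EΛ, mul_monomial]
  split_ifs with h
  · subst h; simp
  · simp [Matrix.mul_single_apply_of_ne _ _ _ _ _ (Ne.symm h)]

theorem series_mul_diag_one_apply (X : BoundedSeries (Mat N) v) (c : Fin N → ℤ) (l p : ℤ)
    (i₀ k₀ : Fin N) : (X * diag c 1).series l p i₀ k₀ = X.series (l - c k₀) p i₀ k₀ := by
  simp only [diag, Pi.one_apply, mul_one, Finset.mul_sum, series_sum, Finset.sum_apply,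
    Matrix.sum_apply, series_mul_single_apply]
  simp

theorem tsum_smul_apply (X : BoundedSeries (Mat N) v) (k : Fin N) (c l p : ℤ)
    {f : PowerSeries (TimeRing N)} (hf : DegreeLE 0 (ofPowerSeries ℤ (Mat N) f)) (i₀ k₀ : Fin N) :
    (X * single v k c * mk (ofPowerSeries ℤ (Mat N) f) hf).series l p i₀ k₀ =
      if k = k₀ then ∑' i : ℤ, laurentCoeff f i * X.series (l - i - c) p i₀ k₀ else 0 := by
  have hs : Summable fun i : ℤ => laurentCoeff f i • (X * single v k c).series (l - i) p := by
    have h := (wsummable_mul (X * single v k c) (mk _ hf) l p).summable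
    rw [← (Equiv.subLeft l).summable_iff] at h
    refine h.congr fun i => ?_
    simp [ofPowerSeries]
  rw [series_mul, series_mk, mul_ofPowerSeries, Mat.tsum_apply hs]
  simp only [Matrix.smul_apply, series_mul_single_apply, smul_eq_mul]
  split_ifs
  · rfl
  · simp

theorem series_mul_diag_expTime_apply (X : BoundedSeries (Mat N) v) (c : Fin N → ℤ)
    (a : Fin N → Idx N) (l p : ℤ) (i₀ k₀ : Fin N) :
    (X * diag c fun k => ↑(expTime (Mat N) v (a k))).series l p i₀ k₀ =
      ∑' i : ℤ, expCoeff (a k₀) i * X.series (l - i - c k₀) p i₀ k₀ := by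
  simp only [diag, Finset.mul_sum, series_sum, Finset.sum_apply, Matrix.sum_apply]
  rw [Finset.sum_eq_single k₀]
  · rw [← mul_assoc]
    exact (tsum_smul_apply X k₀ _ l p (degreeLE_expPowerSeries _) i₀ k₀).trans (if_pos rfl)
  · intro k _ hk
    rw [← mul_assoc]
    exact (tsum_smul_apply X k _ l p (degreeLE_expPowerSeries _) i₀ k₀).trans (if_neg hk)
  · simp

theorem series_mul_diag_expTime_inv_apply (X : BoundedSeries (Mat N) v) (c : Fin N → ℤ)
    (a : Fin N → Idx N) (l p : ℤ) (i₀ k₀ : Fin N) :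
    (X * diag c fun k => ↑(expTime (Mat N) v (a k))⁻¹).series l p i₀ k₀ =
      ∑' i : ℤ, expNegCoeff (a k₀) i * X.series (l - i - c k₀) p i₀ k₀ := by
  simp only [diag, Finset.mul_sum, series_sum, Finset.sum_apply, Matrix.sum_apply]
  rw [Finset.sum_eq_single k₀]
  · rw [← mul_assoc]
    exact (tsum_smul_apply X k₀ _ l p (degreeLE_expPowerSeries_neg _) i₀ k₀).trans (if_pos rfl)
  · intro k _ hk
    rw [← mul_assoc]
    exact (tsum_smul_apply X k _ l p (degreeLE_expPowerSeries_neg _) i₀ k₀).trans (if_neg hk)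
  · simp

/-- The series `∑_k E_kk Θ^{c_k} exp(∑_{j≥1} t_{j,a_k} Θ^j)` as an invertible series. -/
def vacuum (v : ℤ) (c : Fin N → ℤ) (a : Fin N → Idx N) : (BoundedSeries (Mat N) v)ˣ where
  val := diag c fun k => ↑(expTime (Mat N) v (a k))
  inv := diag (-c) fun k => ↑(expTime (Mat N) v (a k))⁻¹
  val_inv := by
    rw [diag_mul_diag _ _ _ fun k l j => commute_expTime_single _ _ _, add_neg_cancel,
      ← diag_zero_one]
    congr 1
    funext k
    simp
  inv_val := by
    rw [diag_mul_diag _ _ _ fun k l j => (commute_expTime_single _ _ _).units_inv_left,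
      neg_add_cancel, ← diag_zero_one]
    congr 1
    funext k
    simp

/-- The exponentials do not depend on the charges and cancel; only the diagonal shift by the
difference of charges survives. -/
theorem vacuum_mul_inv (c c' : Fin N → ℤ) (a : Fin N → Idx N) :
    (↑(vacuum v c' a) : BoundedSeries (Mat N) v) * (↑(vacuum v c a)⁻¹ : BoundedSeries (Mat N) v) =
      diag (c' - c) 1 := by
  refine (diag_mul_diag _ _ _ fun k l j => commute_expTime_single _ _ _).trans ?_
  rw [← sub_eq_add_neg]
  congr 1
  funext k
  simp

theorem boundedBelow_diag (c : Fin N → ℤ) {x : Fin N → BoundedSeries (Mat N) v}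
    (hx : ∀ k, BoundedBelow (x k).series) : BoundedBelow (diag c x).series := by
  rw [diag, series_sum]
  refine Finset.sum_induction _ BoundedBelow ?_ ⟨0, fun _ _ _ => rfl⟩ fun k _ => ?_
  · rintro X Y ⟨a, ha⟩ ⟨b, hb⟩
    refine ⟨min a b, fun j hj p => ?_⟩
    rw [Pi.add_apply, Pi.add_apply, ha j (by omega) p, hb j (by omega) p, add_zero]
  · obtain ⟨m, hm⟩ := hx k
    refine ⟨m + c k, fun j hj p => ?_⟩
    rw [series_mul, series_single, EΛ, monomial_mul, hm _ (by omega), mul_zero]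

theorem boundedBelow_vacuum (c : Fin N → ℤ) (a : Fin N → Idx N) :
    BoundedBelow (vacuum v c a : BoundedSeries (Mat N) v).series :=
  boundedBelow_diag c fun _ => boundedBelow_ofPowerSeries _

theorem boundedBelow_vacuum_inv (c : Fin N → ℤ) (a : Fin N → Idx N) :
    BoundedBelow (↑(vacuum v c a)⁻¹ : BoundedSeries (Mat N) v).series :=
  boundedBelow_diag (-c) fun _ => boundedBelow_ofPowerSeries _

/-- No degree bound on Y is available, but x⁻¹(xY) = (x⁻¹x)Y needs only that x and x⁻¹ have bounded
degree and are bounded below. -/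
theorem eq_inv_of_mul_eq_one {x : (BoundedSeries (Mat N) v)ˣ}
    (hx : BoundedBelow (x : BoundedSeries (Mat N) v).series)
    (hx' : BoundedBelow (↑x⁻¹ : BoundedSeries (Mat N) v).series) {Y : MatSeries N}
    (hY : Toda.mul v (x : BoundedSeries (Mat N) v).series Y = one) :
    Y = (↑x⁻¹ : BoundedSeries (Mat N) v).series := by
  obtain ⟨d, hd⟩ := exists_degreeLE (x : BoundedSeries (Mat N) v)
  obtain ⟨e, he⟩ := exists_degreeLE (↑x⁻¹ : BoundedSeries (Mat N) v)
  have h := mul_assoc_of_boundedBelow v he hx' hd hx (Z := Y)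
  rw [hY, ← series_mul, Units.inv_mul, ← series_one (v := v), ← series_mul, mul_one] at h
  rw [← h]
  funext l p
  rw [series_one, one, monomial_mul]
  simp

theorem degreeLE_diag_one {c : Fin N → ℤ} {d : ℤ} (h : ∀ k, c k ≤ d) :
    DegreeLE d (diag (v := v) c 1).series := by
  rw [diag, series_sum]
  refine DegreeLE.sum fun k _ => ?_
  rw [Pi.one_apply, mul_one]
  exact (degreeLE_monomial (c k) _).mono (h k)

end BoundedSeries

/-! ## The two sides of the factorization problem -/

/-- `1` for the unbarred and `-1` for the barred side. -/
def sideSign (b : Bool) : ℤ := if b then 1 else -1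

theorem sideSign_mul_self (b : Bool) : sideSign b * sideSign b = 1 := by cases b <;> rfl

/-- The index `k` on the unbarred and `k̄` on the barred side. -/
def sideIdx {N : ℕ} (b : Bool) (k : Fin N) : Idx N := if b then Sum.inl k else Sum.inr k

/-- The series `X` written in terms of `Λ` on the unbarred and of `Λ⁻¹` on the barred side. -/
def rev {N : ℕ} (b : Bool) (X : MatSeries N) : MatSeries N := fun j => X (sideSign b * j)

section Rev

variable {N : ℕ}

theorem rev_apply (b : Bool) (X : MatSeries N) (j n : ℤ) :
    X j n = rev b X (sideSign b * j) n := by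
  rw [rev, ← mul_assoc, sideSign_mul_self, one_mul]

theorem mul_rev (b : Bool) (X Y : MatSeries N) :
    mul (sideSign b) (rev b X) (rev b Y) = rev b (mul 1 X Y) := by
  funext j p
  have h : ∀ i, sideSign b * (sideSign b * i) = i := fun i => by
    rw [← mul_assoc, sideSign_mul_self, one_mul]
  have h' : ∀ i, sideSign b * i * sideSign b = i := fun i => by rw [mul_comm, h]
  let e : ℤ ≃ ℤ := ⟨fun i => sideSign b * i, fun i => sideSign b * i, h, h⟩
  rw [rev, mul, mul, ← e.tsum_eq]
  refine tsum_congr fun i => ?_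
  simp only [rev, mul_sub, e, Equiv.coe_fn_mk, smul_eq_mul, mul_one, h, h']

theorem rev_monomial (b : Bool) (j : ℤ) (f : ℤ → Mat N) :
    rev b (monomial (sideSign b * j) f) = monomial j f := by
  funext i p
  have : sideSign b * i = sideSign b * j ↔ i = j := by cases b <;> simp [sideSign]
  simp only [rev, monomial, this]

theorem rev_one (b : Bool) : rev b (one : MatSeries N) = one := by
  have := rev_monomial b 0 fun _ => (1 : Mat N)
  rwa [mul_zero] at this

theorem rev_npow (b : Bool) (X : MatSeries N) (m : ℕ) :
    rev b (npow 1 X m) = npow (sideSign b) (rev b X) m := by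
  induction m with
  | zero => exact rev_one b
  | succ m ih => rw [npow, npow, ← mul_rev, ih]

theorem rev_exp (b : Bool) (X : MatSeries N) : rev b (exp 1 X) = exp (sideSign b) (rev b X) := by
  funext j p
  simp only [exp, rev]
  refine tsum_congr fun m => ?_
  congr 1
  exact congrFun (congrFun (rev_npow b X m) j) p

theorem rev_sum {ι : Type*} (b : Bool) (s : Finset ι) (X : ι → MatSeries N) :
    rev b (∑ i ∈ s, X i) = ∑ i ∈ s, rev b (X i) := by
  funext j p
  simp [rev]

end Rev

/-- The element `x` of `𝔤` is represented by the series `y` of bounded degree. -/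
def Represents {N : ℕ} {𝔤 : LaurentAlgebra N} (b : Bool) (x : 𝔤.Elem)
    (y : BoundedSeries (Mat N) (sideSign b)) : Prop := rev b x.series = y.series

namespace Represents

variable {N : ℕ} {𝔤 : LaurentAlgebra N} {b : Bool}

theorem mul {x x' : 𝔤.Elem} {y y' : BoundedSeries (Mat N) (sideSign b)} (h : Represents b x y)
    (h' : Represents b x' y') : Represents b (x * x') (y * y') := by
  unfold Represents
  rw [LaurentAlgebra.Elem.series_mul, ← mul_rev, h, h']
  rfl

theorem one : Represents b (1 : 𝔤.Elem) 1 := rev_one b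

theorem pow {x : 𝔤.Elem} {y : BoundedSeries (Mat N) (sideSign b)} (h : Represents b x y)
    (i : ℕ) : Represents b (x ^ i) (y ^ i) := by
  induction i with
  | zero => rw [pow_zero, pow_zero]; exact one
  | succ i ih => rw [pow_succ, pow_succ]; exact ih.mul h

theorem zpow {x : 𝔤.Elemˣ} {y : (BoundedSeries (Mat N) (sideSign b))ˣ}
    (h : Represents b (x : 𝔤.Elem) y) (h' : Represents b (↑x⁻¹ : 𝔤.Elem) ↑y⁻¹) (j : ℤ) :
    Represents b (↑(x ^ j) : 𝔤.Elem) ↑(y ^ j) := by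
  induction j with
  | zero => exact one
  | succ m ih =>
    rw [zpow_add_one, zpow_add_one]
    exact ih.mul h
  | pred m ih =>
    rw [zpow_sub_one, zpow_sub_one]
    exact ih.mul h'

end Represents

namespace Factorization

variable {N : ℕ} {𝔤 : LaurentAlgebra N} (D : Factorization 𝔤) (b : Bool) (s : Charge N)

/-- `S` or `S̄`. -/
def sideS : 𝔤.Elemˣ := if b then D.S s else D.Sbar s

/-- `W₀` or `W̄₀`. -/
def sideW₀ : 𝔤.Elemˣ := if b then D.W₀ s else D.W₀bar s

/-- `W` or `W̄`. -/
def sideW : 𝔤.Elemˣ := D.sideS b s * D.sideW₀ b s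

theorem sideW_false : D.sideW false s = D.Wbar s := rfl

/-- The factorization says W̄ = W g with the same g for all charges, so g drops out of the quotient.
This is the only link between the two sides apart from the string equation. -/
theorem sideW_mul_inv (s' : Charge N) :
    D.sideW b s' * (D.sideW b s)⁻¹ = D.W s' * (D.W s)⁻¹ := by
  cases b
  · rw [sideW_false, sideW_false]
    have h : ∀ s, D.Wbar s = D.W s * D.g := fun s => (D.factorization s).symm
    rw [h, h, mul_inv_rev, mul_assoc, mul_inv_cancel_left]
  · rfl

theorem rev_sideS_of_pos {j : ℤ} (hj : 0 < j) (n : ℤ) :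
    rev b (D.sideS b s : 𝔤.Elem).series j n = 0 := by
  cases b
  · exact D.Sbar_mem s _ (Or.inl rfl) _ (by simp only [sideSign]; simpa using hj) n
  · exact (D.S_mem s _ (Or.inl rfl)).2 _ (by simp only [sideSign]; simpa using hj) n

theorem rev_sideS_inv_of_pos {j : ℤ} (hj : 0 < j) (n : ℤ) :
    rev b (↑(D.sideS b s)⁻¹ : 𝔤.Elem).series j n = 0 := by
  cases b
  · exact D.Sbar_mem s _ (Or.inr rfl) _ (by simp only [sideSign]; simpa using hj) n
  · exact (D.S_mem s _ (Or.inr rfl)).2 _ (by simp only [sideSign]; simpa using hj) n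

/-- The series of `S` or `S̄`. -/
def serS : (BoundedSeries (Mat N) (sideSign b))ˣ where
  val := .mk (rev b (D.sideS b s : 𝔤.Elem).series)
    (degreeLE_of_lower fun _ hj n => D.rev_sideS_of_pos b s hj n)
  inv := .mk (rev b (↑(D.sideS b s)⁻¹ : 𝔤.Elem).series)
    (degreeLE_of_lower fun _ hj n => D.rev_sideS_inv_of_pos b s hj n)
  val_inv := by
    ext1
    simp only [BoundedSeries.series_mul, BoundedSeries.series_mk, mul_rev]
    rw [← LaurentAlgebra.Elem.series_mul, Units.mul_inv]
    exact rev_one b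
  inv_val := by
    ext1
    simp only [BoundedSeries.series_mul, BoundedSeries.series_mk, mul_rev]
    rw [← LaurentAlgebra.Elem.series_mul, Units.inv_mul]
    exact rev_one b

/-- The series of `W₀` or `W̄₀`. -/
def serW₀ : (BoundedSeries (Mat N) (sideSign b))ˣ :=
  BoundedSeries.vacuum (sideSign b) (fun k => s.1 (sideIdx b k)) (sideIdx b)

/-- The series of `W` or `W̄`. -/
def serW : (BoundedSeries (Mat N) (sideSign b))ˣ := D.serS b s * serW₀ b s

theorem represents_W₀ : Represents b (D.sideW₀ b s : 𝔤.Elem) (serW₀ b s) := by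
  have h : (D.sideW₀ b s : 𝔤.Elem).series = ∑ k : Fin N,
      mul 1 (EΛ k (sideSign b * s.1 (sideIdx b k)))
        (exp 1 fun j _ => time (sideIdx b k) (sideSign b * j) • (1 : Mat N)) := by
    cases b
    · refine (D.W₀bar_eq s).trans ?_
      simp [W₀barSeries, sideSign, sideIdx]
    · refine (D.W₀_eq s).trans ?_
      simp [W₀Series, sideSign, sideIdx]
  unfold Represents
  rw [h, rev_sum]
  simp only [serW₀, BoundedSeries.vacuum, BoundedSeries.diag, BoundedSeries.series_sum]
  refine Finset.sum_congr rfl fun k _ => ?_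
  rw [← mul_rev, BoundedSeries.series_mul, BoundedSeries.series_expTime, rev_exp, EΛ, rev_monomial]
  congr 2
  funext j p
  simp only [rev, ← mul_assoc, sideSign_mul_self, one_mul]

/-- Membership in 𝔤 says nothing about the degree of this inverse; uniqueness of the right inverse
identifies it with the explicit one. -/
theorem represents_W₀_inv : Represents b (↑(D.sideW₀ b s)⁻¹ : 𝔤.Elem) ↑(serW₀ b s)⁻¹ := by
  refine BoundedSeries.eq_inv_of_mul_eq_one (BoundedSeries.boundedBelow_vacuum _ _)
    (BoundedSeries.boundedBelow_vacuum_inv _ _) ?_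
  have h := D.represents_W₀ b s
  unfold Represents serW₀ at h
  rw [← h, mul_rev, ← LaurentAlgebra.Elem.series_mul, Units.mul_inv]
  exact rev_one b

theorem represents_W : Represents b (D.sideW b s : 𝔤.Elem) (D.serW b s) :=
  Represents.mul (x := (D.sideS b s : 𝔤.Elem)) rfl (D.represents_W₀ b s)

theorem represents_W_inv : Represents b (↑(D.sideW b s)⁻¹ : 𝔤.Elem) ↑(D.serW b s)⁻¹ := by
  rw [sideW, serW, mul_inv_rev, mul_inv_rev]
  exact (D.represents_W₀_inv b s).mul (x' := (↑(D.sideS b s)⁻¹ : 𝔤.Elem)) rfl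

end Factorization

/-! ## Lax and Orlov--Schulman operators on the two sides -/

/-- Series of bounded degree in `Λ` on the unbarred and in `Λ⁻¹` on the barred side. -/
abbrev SideSeries (N : ℕ) (b : Bool) := BoundedSeries (Mat N) (sideSign b)

namespace Factorization

section Sides

variable {N : ℕ} {𝔤 : LaurentAlgebra N} (D : Factorization 𝔤) (b : Bool) (s : Charge N)

/-- The matrix valued function `n ↦ n`. -/
def position (N : ℕ) (n : ℤ) : Mat N := (n : Mat N)

theorem represents_n : Represents b 𝔤.n (BoundedSeries.const (sideSign b) (position N)) := by
  have := rev_monomial b 0 (position N)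
  rwa [mul_zero] at this

theorem represents_E (k : Fin N) :
    Represents b (𝔤.E k) (BoundedSeries.single (sideSign b) k 0) := by
  have := rev_monomial b 0 fun _ => (Matrix.single k k 1 : Mat N)
  rwa [mul_zero] at this

/-- `Λ` or `Λ⁻¹`. -/
def sideShift (𝔤 : LaurentAlgebra N) (b : Bool) : 𝔤.Elemˣ := if b then 𝔤.Λ else 𝔤.Λ⁻¹

theorem represents_shift : Represents b (sideShift 𝔤 b : 𝔤.Elem)
    (BoundedSeries.shift (Mat N) (sideSign b)) := by
  cases b
  · exact rev_monomial false 1 fun _ => (1 : Mat N)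
  · exact rev_monomial true 1 fun _ => (1 : Mat N)

theorem represents_shift_inv : Represents b (↑(sideShift 𝔤 b)⁻¹ : 𝔤.Elem)
    ↑(BoundedSeries.shift (Mat N) (sideSign b))⁻¹ := by
  cases b
  · exact rev_monomial false (-1) fun _ => (1 : Mat N)
  · exact rev_monomial true (-1) fun _ => (1 : Mat N)

/-- `F(M, L)` or `F(M̄, L̄⁻¹)`. -/
def sideEval (F : ℕ → ℤ → ℂ) : MatSeries N := if b then D.evalML s F else D.evalMLbar s F

/-- `C_kk` or `C̄_kk`. -/
def sideC (k : Fin N) : 𝔤.Elem := if b then D.C s k else D.Cbar s k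

/-- `∑_k F_k(M, L) C_kk` or `∑_k F_k̄(M̄, L̄⁻¹) C̄_kk`. -/
def sideSum (F : Idx N → ℕ → ℤ → ℂ) : MatSeries N :=
  ∑ k : Fin N, mul 1 (D.sideEval b s (F (sideIdx b k))) (D.sideC b s k).series

/-- The series of `M^i L^j` or `M̄^i L̄^{-j}`. -/
def serB (i : ℕ) (j : ℤ) : SideSeries N b :=
  D.serW b s * BoundedSeries.const (sideSign b) (position N ^ i) *
    ↑(BoundedSeries.shift (Mat N) (sideSign b) ^ j) * ↑(D.serW b s)⁻¹

theorem represents_C (k : Fin N) : Represents b (D.sideC b s k)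
    (D.serW b s * BoundedSeries.single (sideSign b) k 0 * ↑(D.serW b s)⁻¹) := by
  have h : D.sideC b s k = D.sideW b s * 𝔤.E k * ↑(D.sideW b s)⁻¹ := by cases b <;> rfl
  rw [h]
  exact ((D.represents_W b s).mul (represents_E b k)).mul (D.represents_W_inv b s)

theorem represents_pow_mul_zpow (i : ℕ) (j : ℤ) :
    Represents b ((D.sideW b s * 𝔤.n * ↑(D.sideW b s)⁻¹ : 𝔤.Elem) ^ i *
      (↑((D.sideW b s * sideShift 𝔤 b * (D.sideW b s)⁻¹) ^ j) : 𝔤.Elem)) (D.serB b s i j) := by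
  have hu := D.represents_W b s
  have hu' := D.represents_W_inv b s
  have h := ((((hu.mul (represents_n b)).mul hu').pow i).mul
    ((hu.mul ((represents_shift b).zpow (represents_shift_inv b) j)).mul hu'))
  rw [conj_zpow, Units.val_mul, Units.val_mul]
  convert h using 1
  rw [Units.conj_pow, BoundedSeries.const_pow, serB]
  simp only [mul_assoc, Units.inv_mul_cancel_left]

/-- Insertion is coefficientwise, so it commutes with reversing the powers. On the barred side it is
L̄⁻¹ that is conjugate to the basic shift Λ⁻¹. -/
theorem rev_sideEval (F : ℕ → ℤ → ℂ) :
    rev b (D.sideEval b s F) = evalSeries F fun i j => (D.serB b s i j).series := by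
  have h : ∀ i j, rev b ((D.sideW b s * 𝔤.n * ↑(D.sideW b s)⁻¹ : 𝔤.Elem) ^ i *
      (↑((D.sideW b s * sideShift 𝔤 b * (D.sideW b s)⁻¹) ^ j) : 𝔤.Elem)).series =
      (D.serB b s i j).series := D.represents_pow_mul_zpow b s
  simp only [← h]
  cases b
  · have : (D.Lbar s)⁻¹ = D.sideW false s * sideShift 𝔤 false * (D.sideW false s)⁻¹ := by
      rw [Lbar, mul_inv_rev, mul_inv_rev, inv_inv, ← mul_assoc]
      rfl
    change rev false (D.evalMLbar s F) = _
    rw [evalMLbar, this]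
    rfl
  · rfl

theorem exists_degreeLE_serB : ∃ d, ∀ i j, DegreeLE (j + d) (D.serB b s i j).series := by
  obtain ⟨d, hd⟩ := (D.serW b s : SideSeries N b).exists_degreeLE
  obtain ⟨e, he⟩ := (↑(D.serW b s)⁻¹ : SideSeries N b).exists_degreeLE
  refine ⟨d + e, fun i j => ?_⟩
  have := ((hd.mul (degreeLE_monomial 0 (position N ^ i)) (sideSign b)).mul
    (degreeLE_monomial j fun _ => (1 : Mat N)) (sideSign b)).mul he (sideSign b)
  rw [serB, BoundedSeries.series_mul, BoundedSeries.series_mul, BoundedSeries.series_mul,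
    BoundedSeries.series_shift_zpow]
  exact this.mono (by omega)

/-- The series of `F(M, L)` or `F(M̄, L̄⁻¹)`. -/
def serEval {F : ℕ → ℤ → ℂ} (hF : Admissible F) : SideSeries N b :=
  ⟨evalSeries F fun i j => (D.serB b s i j).series, by
    obtain ⟨d, hd⟩ := D.exists_degreeLE_serB b s
    obtain ⟨r, hr⟩ := hF.1
    exact ⟨r + d, degreeLE_evalSeries hr hd⟩⟩

theorem intCast_mul_apply (x : Mat N) (z : ℤ) (i : ℕ) (i₀ k₀ : Fin N) :
    (x * (z : Mat N) ^ i) i₀ k₀ = x i₀ k₀ * (z : TimeRing N) ^ i := by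
  rw [← Int.cast_pow, ← Int.cast_pow, ← zsmul_eq_mul', ← zsmul_eq_mul', Matrix.smul_apply]

/-- After multiplication by W the factor W⁻¹ of M^i L^j cancels, leaving W n^i times a shift. The
polynomial in n is evaluated at the point reached by the preceding power in W. -/
theorem serEval_mul_serW_apply {F : ℕ → ℤ → ℂ} (hF : Admissible F) (l n : ℤ) (i₀ k₀ : Fin N) :
    (D.serEval b s hF * D.serW b s).series l n i₀ k₀ =
      ∑' q : ℕ × ℤ, F q.1 q.2 • ((D.serW b s : SideSeries N b).series (l - q.2) n i₀ k₀ *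
        ((n + (l - q.2) * sideSign b : ℤ) : TimeRing N) ^ q.1) := by
  obtain ⟨d, hd⟩ := D.exists_degreeLE_serB b s
  obtain ⟨e, he⟩ := (D.serW b s : SideSeries N b).exists_degreeLE
  have h := evalSeries_mul (sideSign b) hF hd he l n
  have hs : WSummable (sumTerm F (fun i j => (D.serB b s i j * D.serW b s).series) l n) := by
    refine hF.wsummable_sumTerm (d := d + e) (fun i j => ?_) l n
    rw [← add_assoc]
    exact (hd i j).mul he _
  rw [BoundedSeries.series_mul]
  refine (congrFun (congrFun h i₀) k₀).trans ((Mat.tsum_apply hs.summable i₀ k₀).trans ?_)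
  refine tsum_congr fun q => ?_
  simp only [sumTerm, Matrix.smul_apply]
  congr 1
  rw [serB, Units.inv_mul_cancel_right, BoundedSeries.series_mul_const_mul_shift]
  exact intCast_mul_apply _ _ _ _ _

/-- The series of `∑_k F_k(M, L) C_kk` or `∑_k F_k̄(M̄, L̄⁻¹) C̄_kk`. -/
def serSum {F : Idx N → ℕ → ℤ → ℂ} (hF : ∀ a, Admissible (F a)) :
    SideSeries N b :=
  ∑ k : Fin N, D.serEval b s (hF (sideIdx b k)) *
    (D.serW b s * BoundedSeries.single (sideSign b) k 0 * ↑(D.serW b s)⁻¹)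

theorem rev_sideSum {F : Idx N → ℕ → ℤ → ℂ} (hF : ∀ a, Admissible (F a)) :
    rev b (D.sideSum b s F) = (D.serSum b s hF).series := by
  rw [sideSum, rev_sum, serSum, BoundedSeries.series_sum]
  refine Finset.sum_congr rfl fun k _ => ?_
  rw [← mul_rev, D.represents_C b s k, rev_sideEval]
  rfl

/-- Since C_kk W = W E_kk, column k₀ sees only the summand with index k₀. -/
theorem serSum_mul_serW_apply {F : Idx N → ℕ → ℤ → ℂ} (hF : ∀ a, Admissible (F a)) (l n : ℤ)
    (i₀ k₀ : Fin N) : (D.serSum b s hF * D.serW b s).series l n i₀ k₀ =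
      (D.serEval b s (hF (sideIdx b k₀)) * D.serW b s).series l n i₀ k₀ := by
  rw [serSum, Finset.sum_mul, BoundedSeries.series_sum, Finset.sum_apply, Finset.sum_apply,
    Matrix.sum_apply]
  have h : ∀ k, D.serEval b s (hF (sideIdx b k)) *
      (D.serW b s * BoundedSeries.single (sideSign b) k 0 * ↑(D.serW b s)⁻¹) * D.serW b s =
      D.serEval b s (hF (sideIdx b k)) * D.serW b s * BoundedSeries.single (sideSign b) k 0 := by
    intro k
    simp only [mul_assoc, Units.inv_mul, mul_one]
  simp only [h, BoundedSeries.series_mul_single_apply]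
  simp

/-- The series of `W(s') W(s)⁻¹ = W̄(s') W̄(s)⁻¹`. -/
def serR (s' s : Charge N) : SideSeries N b :=
  D.serW b s' * ↑(D.serW b s)⁻¹

theorem represents_R (s' s : Charge N) :
    Represents b (↑(D.W s' * (D.W s)⁻¹) : 𝔤.Elem) (D.serR b s' s) := by
  rw [← D.sideW_mul_inv b]
  exact (D.represents_W b s').mul (D.represents_W_inv b s)

theorem serR_mul_serW (s' s : Charge N) :
    D.serR b s' s * D.serW b s = (D.serW b s' : SideSeries N b) := by
  rw [serR, Units.inv_mul_cancel_right]

/-- W(s')W(s)⁻¹S(s) = S(s') W₀(s') W₀(s)⁻¹, and the vacuum factors combine to pure shifts. -/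
theorem serR_mul_serS (s' s : Charge N) : D.serR b s' s * (D.serS b s : SideSeries N b) =
    (D.serS b s' : SideSeries N b) * BoundedSeries.diag
      ((fun k => s'.1 (sideIdx b k)) - fun k => s.1 (sideIdx b k)) 1 := by
  rw [← BoundedSeries.vacuum_mul_inv, serR, serW, serW, mul_inv_rev]
  simp only [Units.val_mul, mul_assoc, Units.inv_mul, mul_one]
  rfl

theorem degreeLE_serS : DegreeLE 0 (D.serS b s : SideSeries N b).series :=
  degreeLE_of_lower fun _ hj n => D.rev_sideS_of_pos b s hj n

theorem degreeLE_serS_inv : DegreeLE 0 (↑(D.serS b s)⁻¹ : SideSeries N b).series :=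
  degreeLE_of_lower fun _ hj n => D.rev_sideS_inv_of_pos b s hj n

theorem degreeLE_serR {s' s : Charge N} {d : ℤ} (h : ∀ a, s'.1 a - s.1 a ≤ d) :
    DegreeLE d (D.serR b s' s).series := by
  have e : D.serR b s' s = (D.serS b s' : SideSeries N b) * BoundedSeries.diag
      ((fun k => s'.1 (sideIdx b k)) - fun k => s.1 (sideIdx b k)) 1 *
        (↑(D.serS b s)⁻¹ : SideSeries N b) := by
    rw [← serR_mul_serS, Units.mul_inv_cancel_right]
  rw [e]
  have := ((D.degreeLE_serS b s').mul (BoundedSeries.degreeLE_diag_one (v := sideSign b)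
    (c := (fun k => s'.1 (sideIdx b k)) - fun k => s.1 (sideIdx b k)) (d := d)
    fun k => h (sideIdx b k)) (sideSign b)).mul (D.degreeLE_serS_inv b s) (sideSign b)
  simpa using this

end Sides

/-! ## Scalar operators as matrix entries -/

section Entries

variable {N : ℕ} [NeZero N] {𝔤 : LaurentAlgebra N} {D : Factorization 𝔤} (b : Bool)
  (s : Charge N) (k : Fin N) (n : ℤ)

theorem entry_congr {X : MatSeries N} {l l' : ℤ} (h : l = l') (i₀ k₀ : Fin N) :
    X l n i₀ k₀ = X l' n i₀ k₀ := by rw [h]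

theorem sg_sideIdx : sg (sideIdx b k) = sideSign b := by cases b <;> rfl

theorem ν_mul_sideSign : ν (sideIdx b k) * sideSign b = ν (sideIdx b k) := by
  cases b <;> simp [sideSign, sideIdx, ν]

variable (D) in
-- K_a lists the first-row entries of S or S̄. The offset ν_a appears because S starts with the
-- identity, so its off-diagonal entries begin one power lower.
theorem K_sideIdx (j : ℤ) : D.K (sideIdx b k) n j s =
    (D.serS b s : SideSeries N b).series (j - ν (sideIdx b k)) n 0 k := by
  change _ = rev b (D.sideS b s : 𝔤.Elem).series (j - ν (sideIdx b k)) n 0 k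
  rcases le_or_gt j 0 with hj | hj
  · cases b
    · simp [K, hj, sideIdx, rev, sideSign, ν, sideS]
    · by_cases hk : k = 0 <;> simp [K, hj, sideIdx, rev, sideSign, ν, sideS, hk]
  · rw [K_of_pos D _ _ _ hj]
    rcases lt_or_ge 0 (j - ν (sideIdx b k)) with h | h
    · rw [D.rev_sideS_of_pos b s h]
      rfl
    · cases b
      · simp [ν, sideIdx] at h; omega
      · by_cases hk : k = 0
        · simp [ν, sideIdx, hk] at h; omega
        · have : j - ν (sideIdx true k) = 0 := by
            simp [ν, sideIdx, hk] at h ⊢; omega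
          rw [this]
          simp [rev, sideS, S_zero, Matrix.one_apply_ne (Ne.symm hk)]

/-- Right multiplication by an exponential with constant coefficients is the same convolution of
coefficients for charge shifts and for shifts of n. The two sides differ only by the offset ν and by
the power s_a of the shift in W₀ or W̄₀. -/
theorem scalarW_sideIdx (v : Charge N) (l : ℤ) : D.scalarW v (sideIdx b k) n l s =
    (D.serW b s : SideSeries N b).series (l - ν (sideIdx b k) + s.1 (sideIdx b k)) n 0 k := by
  rw [serW, Units.val_mul]
  refine Eq.trans ?_ (BoundedSeries.series_mul_diag_expTime_apply _ _ _ _ _ _ _).symm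
  let x : BoundedSeries (TimeRing N) v :=
    .mk (D.K (sideIdx b k) n) (degreeLE_of_lower (D.K_of_pos _ n))
  have h : D.scalarW v (sideIdx b k) n =
      (x * ↑(BoundedSeries.expTime (TimeRing N) v (sideIdx b k))).series := by
    rw [scalarW, timeSeries_eq, ← BoundedSeries.series_expTime]
    rfl
  rw [h, BoundedSeries.series_mul_expTime]
  refine tsum_congr fun i => ?_
  rw [smul_eq_mul]
  congr 1
  exact (D.K_sideIdx b s k n (l - i)).trans (entry_congr n (by ring) 0 k)

variable (D) in
theorem Ψ_sideIdx (m : ℤ) : D.Ψ (sideIdx b k) n s m =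
    (D.serW b s : SideSeries N b).series (sideSign b * (m - n)) n 0 k := by
  have hact : ∀ X : MatSeries N, act 1 X (χ N) n m = X (m - n) n := by
    intro X
    unfold act actTerm χ
    rw [tsum_eq_single (m - n)]
    · rw [if_pos (by simp), mul_one]
    · intro j hj
      rw [if_neg, mul_zero]
      intro h
      apply hj
      rw [h]
      simp
  rw [← D.represents_W b s, ← rev_apply]
  cases b
  · exact congrFun (congrFun (hact _) 0) k
  · exact congrFun (congrFun (hact _) 0) k

theorem Ψ_eq_scalarW (v : Charge N) (m : ℤ) : D.Ψ (sideIdx b k) n s m =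
    D.scalarW v (sideIdx b k) n
      (sideSign b * (m - n) + ν (sideIdx b k) - s.1 (sideIdx b k)) s := by
  rw [scalarW_sideIdx, Ψ_sideIdx]
  exact entry_congr n (by ring) 0 k

/-- Compare term by term. One power of 𝒯_a raises s_a by one, which changes the scalar eigenvalue by
sg(a); one power of Λ^{±1} changes n by the same sign. The eigenvalues thus agree once the offset ν
is accounted for. -/
theorem serSum_mul_serW_eq (hD : D.Nondegenerate) {F : Idx N → ℕ → ℤ → ℂ}
    (hF : ∀ a, Admissible (F a)) {v : Charge N} (hv : v.1 (sideIdx b k) = 1) (l : ℤ) :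
    (D.serSum b s hF * D.serW b s).series
        (l - ν (sideIdx b k) + s.1 (sideIdx b k)) n 0 k =
      mul v (D.scalarF v F (sideIdx b k) n) (D.scalarW v (sideIdx b k) n) l s := by
  rw [serSum_mul_serW_apply, serEval_mul_serW_apply, scalarF_mul_scalarW hD v _ n hF]
  refine tsum_congr fun q => ?_
  rw [scalarW_sideIdx]
  refine congrArg₂ (fun x y => F (sideIdx b k) q.1 q.2 • (x * y ^ q.1))
    (entry_congr n (by ring) 0 k) ?_
  · have h1 : (s + (l - q.2) • v).1 (sideIdx b k) = s.1 (sideIdx b k) + (l - q.2) := by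
      change s.1 (sideIdx b k) + (l - q.2) • v.1 (sideIdx b k) = _
      rw [hv, smul_eq_mul, mul_one]
    rw [number, h1, sg_sideIdx]
    congr 1
    have := ν_mul_sideSign b k
    linear_combination -this

/-- Strip W₀ on the matrix side and the exponential on the scalar side from the identity for W; both
amount to the same convolution with exp(-∑ t_{ja} x^j). -/
theorem serSum_mul_serS_eq (hD : D.Nondegenerate) {F : Idx N → ℕ → ℤ → ℂ}
    (hF : ∀ a, Admissible (F a)) {v : Charge N} (hv : v.1 (sideIdx b k) = 1) (l : ℤ) :
    (D.serSum b s hF * D.serS b s).series (l - ν (sideIdx b k)) n 0 k =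
      mul v (D.scalarF v F (sideIdx b k) n) (D.K (sideIdx b k) n) l s := by
  obtain ⟨r, hr⟩ := (hF (sideIdx b k)).1
  let f : BoundedSeries (TimeRing N) v := .mk _ (degreeLE_scalarF hD v n hr)
  have h1 : (D.serSum b s hF * D.serS b s : SideSeries N b) =
      D.serSum b s hF * D.serW b s * ↑(serW₀ b s)⁻¹ := by
    rw [serW, Units.val_mul, ← mul_assoc, Units.mul_inv_cancel_right]
  have h2 : mul v (D.scalarF v F (sideIdx b k) n) (D.K (sideIdx b k) n) =
      (f * dressingW hD v (sideIdx b k) n *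
        ↑(BoundedSeries.expTime (TimeRing N) v (sideIdx b k))⁻¹).series := by
    rw [dressingW, Units.val_mul, ← mul_assoc, Units.mul_inv_cancel_right]
    rfl
  rw [h1, h2, BoundedSeries.series_mul_expTime_inv]
  refine (BoundedSeries.series_mul_diag_expTime_inv_apply _ _ _ _ _ _ _).trans ?_
  refine tsum_congr fun i => ?_
  rw [smul_eq_mul]
  congr 1
  have h3 := serSum_mul_serW_eq b s k n hD hF hv (l - i)
  rw [BoundedSeries.series_mul f, series_dressingW]
  exact (entry_congr n (by rw [Pi.neg_apply]; ring) 0 k).trans h3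

variable (D) in
theorem serR_mul_serS_eq (s' : Charge N) (l : ℤ) :
    (D.serR b s' s * D.serS b s).series (l - ν (sideIdx b k)) n 0 k =
      D.K (sideIdx b k) n (l - (s'.1 (sideIdx b k) - s.1 (sideIdx b k))) s' := by
  rw [serR_mul_serS, BoundedSeries.series_mul_diag_one_apply, K_sideIdx]
  exact entry_congr n (by rw [Pi.sub_apply]; ring) 0 k

end Entries

/-! ## Shifts and projections -/

/-- The properties of the shifts and of the projections on which the wave equations depend. -/
structure IsProjection {N : ℕ} [NeZero N] (v : Idx N → Charge N)
    (pr : Idx N → ShiftSeries (Charge N) (TimeRing N) → ShiftSeries (Charge N) (TimeRing N)) :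
    Prop where
  self : ∀ a, (v a).1 a = 1
  nonpos : ∀ a a', a ≠ a' → (v a').1 a ≤ 0
  of_neg : ∀ a X j s, j < 0 → pr a X j s = 0
  of_pos : ∀ a X j s, 0 < j → pr a X j s = X j s
  zero_one : ∀ X s, pr (Sum.inl 0) X 0 s = X 0 s
  -- Controls the power 0 in column 1, where K_1 has leading coefficient 1. Either the shift lowers
  -- s_1 and dropping the power 0 suffices, or s_1 is unchanged and the coefficients must add up to
  -- zero, as they do for the projection to powers of 𝒯̄^j - 1.
  zero_other : ∀ a ≠ Sum.inl 0,
    ((v a).1 (Sum.inl 0) < 0 ∧ ∀ X s, pr a X 0 s = 0) ∨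
    ((v a).1 (Sum.inl 0) = 0 ∧ ∀ X s, Summable (fun j => partGt X j s) → ∑' j, pr a X j s = 0)

section Projections

variable {N : ℕ} [NeZero N]

theorem step_apply (a b c : Idx N) :
    (step a b).1 c = (if c = a then 1 else 0) - if c = b then 1 else 0 := by
  simp [step, Pi.single_apply]

/-- Every unbarred shift with a ≠ 1 lowers s_1, so the first alternative always applies. -/
theorem isProjection_dir {a₀ : Idx N} (ha₀ : a₀ ≠ Sum.inl 0) :
    IsProjection (dir a₀) plus where
  self a := by
    unfold dir
    split_ifs with h
    · rw [step_apply, h, if_pos rfl, if_neg ha₀.symm, sub_zero]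
    · rw [step_apply, if_pos rfl, if_neg h, sub_zero]
  nonpos a a' h := by
    unfold dir
    split_ifs with h'
    · rw [step_apply, if_neg (h' ▸ h)]
      split_ifs <;> omega
    · rw [step_apply, if_neg h]
      split_ifs <;> omega
  of_neg a X j s hj := by
    unfold plus partGe partGt
    split_ifs
    · exact if_neg (by omega)
    · exact if_neg (by omega)
  of_pos a X j s hj := by
    unfold plus partGe partGt
    split_ifs
    · exact if_pos (by omega)
    · exact if_pos hj
  zero_one X s := by
    rw [plus, if_pos rfl, partGe, if_pos le_rfl]
  zero_other a ha := by
    refine Or.inl ⟨?_, fun X s => ?_⟩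
    · rw [dir, if_neg ha, step_apply, if_neg ha.symm, if_pos rfl]
      omega
    · rw [plus, if_neg ha, partGt, if_neg (lt_irrefl _)]

theorem tsum_partGtSub {X : ShiftSeries (Charge N) (TimeRing N)} {s : Charge N}
    (h : Summable fun j => partGt X j s) : ∑' j, partGtSub X j s = 0 := by
  have h1 : ∀ j, partGtSub X j s =
      partGt X j s + if j = 0 then -∑' i, partGt X i s else 0 := by
    intro j
    unfold partGtSub
    rcases lt_trichotomy j 0 with hj | rfl | hj
    · rw [if_neg (by omega), if_neg (by omega), partGt, if_neg (by omega), zero_add]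
    · have h0 : partGt X 0 s = 0 := if_neg (lt_irrefl _)
      rw [if_neg (by omega), if_pos rfl, h0, zero_add]
    · rw [if_pos hj, if_neg (by omega), partGt, if_pos hj, add_zero]
  simp only [h1]
  rw [h.tsum_add (summable_of_hasFiniteSupport ((Set.finite_singleton 0).subset fun j hj => by
    by_contra hc
    exact hj (if_neg hc))), tsum_ite_eq, add_neg_cancel]

/-- Among the barred shifts with a ≠ 1, only that of 1̄ with `b₀` equal to 1 lowers s_1; all others
fix it and require the normalization of vanishing total coefficient. -/
theorem isProjection_dirBar {b₀ : Idx N} (hb₀ : b₀ ≠ Sum.inr 0) :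
    IsProjection (dirBar b₀) (plusBar b₀) where
  self a := by
    unfold dirBar
    split_ifs with h
    · rw [step_apply, h, if_pos rfl, if_neg hb₀.symm, sub_zero]
    · rw [step_apply, if_pos rfl, if_neg h, sub_zero]
  nonpos a a' h := by
    unfold dirBar
    split_ifs with h'
    · rw [step_apply, if_neg (h' ▸ h)]
      split_ifs <;> omega
    · rw [step_apply, if_neg h]
      split_ifs <;> omega
  of_neg a X j s hj := by
    unfold plusBar partGe partGt partGtSub
    split_ifs
    · exact if_neg (by omega)
    · exact if_neg (by omega)
    · beta_reduce
      rw [if_neg (by omega), if_neg (by omega)]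
  of_pos a X j s hj := by
    unfold plusBar partGe partGt partGtSub
    split_ifs
    · exact if_pos (by omega)
    · exact if_pos hj
    · exact if_pos hj
  zero_one X s := by
    rw [plusBar, if_pos rfl, partGe, if_pos le_rfl]
  zero_other a ha := by
    by_cases h : a = Sum.inr 0 ∧ b₀ = Sum.inl 0
    · refine Or.inl ⟨?_, fun X s => ?_⟩
      · rw [dirBar, if_pos h.1, step_apply, if_neg (by simp), if_pos h.2.symm]
        omega
      · rw [plusBar, if_neg ha, if_pos h, partGt, if_neg (lt_irrefl _)]
    · refine Or.inr ⟨?_, fun X s hs => ?_⟩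
      · unfold dirBar
        split_ifs with h'
        · rw [step_apply, if_neg (by simp), if_neg fun h0 => h ⟨h', h0.symm⟩, sub_zero]
        · rw [step_apply, if_neg ha.symm, if_neg (by simp), sub_zero]
      · rw [plusBar, if_neg ha, if_neg h]
        exact tsum_partGtSub hs

end Projections

namespace IsProjection

variable {N : ℕ} [NeZero N] {v : Idx N → Charge N}
  {pr : Idx N → ShiftSeries (Charge N) (TimeRing N) → ShiftSeries (Charge N) (TimeRing N)}
  {X : ShiftSeries (Charge N) (TimeRing N)} {r : ℤ}

theorem mem_fil (hp : IsProjection v pr) (hr : 0 ≤ r) (hX : DegreeLE r X) (a : Idx N) (j : ℤ)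
    (s : Charge N) : pr a X j s ∈ fil (A := TimeRing N) (j - r) := by
  rcases lt_trichotomy j 0 with hj | rfl | hj
  · rw [hp.of_neg a X j s hj]
    exact Submodule.zero_mem _
  -- The projection may change the coefficient at 0 arbitrarily; r ≥ 0 makes the condition there
  -- empty.
  · exact mem_fil_of_nonpos (by omega) _
  · rw [hp.of_pos a X j s hj]
    exact hX j s

theorem wsummable (hp : IsProjection v pr) (hr : 0 ≤ r) (hX : DegreeLE r X) (a : Idx N)
    (s : Charge N) : WSummable fun j => pr a X j s := by
  refine wsummable_of_Icc fun w => ⟨0, w + r, fun j hj => ?_⟩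
  rcases hj with hj | hj
  · rw [hp.of_neg a X j s hj]
    exact Submodule.zero_mem _
  · exact mem_fil_of_le (by omega) (hp.mem_fil hr hX a j s)

/-- The terms of the wave equation outside the range of the two sides of the factorization
problem: the contribution of the other indices. -/
theorem tsum_mul_K_of_ne (hp : IsProjection v pr) (hr : 0 ≤ r) (hX : DegreeLE r X)
    {𝔤 : LaurentAlgebra N} (D : Factorization 𝔤) {a a' : Idx N} (ha : a ≠ a') (n : ℤ) {l : ℤ}
    (hl : 0 < l ∨ l = 0 ∧ a = Sum.inl 0) (s : Charge N) :
    ∑' j : ℤ, pr a' X j s * D.K a n (l - j * (v a').1 a) (s + j • v a') = 0 := by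
  have hv := hp.nonpos a a' ha
  have hz : ∀ j : ℤ, 0 < l - j * (v a').1 a →
      pr a' X j s * D.K a n (l - j * (v a').1 a) (s + j • v a') = 0 := fun j hj => by
    rw [D.K_of_pos a n _ hj, mul_zero]
  rcases hl with hl | ⟨rfl, rfl⟩
  · refine (tsum_congr fun j => ?_).trans tsum_zero
    rcases lt_or_ge j 0 with hj | hj
    · rw [hp.of_neg a' X j s hj, zero_mul]
    -- The shift does not raise s_a, so for j ≥ 0 the index of K_a stays positive.
    · exact hz j (by nlinarith)
  · rcases hp.zero_other a' ha.symm with ⟨h0, h⟩ | ⟨h0, h⟩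
    · refine (tsum_congr fun j => ?_).trans tsum_zero
      rcases lt_trichotomy j 0 with hj | rfl | hj
      · rw [hp.of_neg a' X j s hj, zero_mul]
      · rw [h, zero_mul]
      · exact hz j (by nlinarith)
    -- Here s_1 is unchanged, every factor is the leading coefficient 1 of K_1, and the sum is the
    -- total coefficient of the projection.
    · have hs : Summable fun j => partGt X j s := by
        refine ((hp.wsummable hr hX a' s).mono fun w j hj => ?_).summable
        unfold partGt
        split_ifs with hj'
        · rwa [hp.of_pos a' X j s hj'] at hj
        · exact Submodule.zero_mem _
      rw [← h X s hs]
      refine tsum_congr fun j => ?_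
      rw [h0, mul_zero, sub_zero, K_inl_zero_zero, mul_one]

/-- The contribution of the same index. -/
theorem tsum_mul_K_self (hp : IsProjection v pr) {𝔤 : LaurentAlgebra N} (D : Factorization 𝔤)
    (a : Idx N) (n : ℤ) {l : ℤ} (hl : 0 < l ∨ l = 0 ∧ a = Sum.inl 0) (s : Charge N) :
    ∑' j : ℤ, pr a X j s * D.K a n (l - j * (v a).1 a) (s + j • v a) =
      mul (v a) X (D.K a n) l s := by
  refine tsum_congr fun j => ?_
  rw [hp.self a, mul_one]
  rcases lt_trichotomy j 0 with hj | rfl | hj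
  -- The discarded negative powers of X would meet positive powers in K_a, which vanish.
  · rw [D.K_of_pos a n _ (by omega), mul_zero, mul_zero]
  · rcases hl with hl | ⟨rfl, rfl⟩
    · rw [D.K_of_pos a n _ (by omega), mul_zero, mul_zero]
    · rw [hp.zero_one]
  · rw [hp.of_pos a X j s hj]

end IsProjection

/-! ## The comparison operator -/

section Compare

variable {N : ℕ} [NeZero N] {𝔤 : LaurentAlgebra N} (D : Factorization 𝔤)

/-- The matrix operator `∑_j c_j W(s + j v) W(s)⁻¹`. -/
def shiftOp (v : Charge N) (s : Charge N) (c : ℤ → ℤ → TimeRing N) : MatSeries N :=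
  fun l n => ∑' j : ℤ, c n j • (↑(D.W (s + j • v) * (D.W s)⁻¹) : 𝔤.Elem).series l n

variable {D} {v s : Charge N} {c : ℤ → ℤ → TimeRing N} {r : ℤ}

theorem rev_shiftOp (b : Bool) : rev b (D.shiftOp v s c) =
    fun l n => ∑' j : ℤ, c n j • (D.serR b (s + j • v) s).series l n := by
  have h : ∀ s', rev b (↑(D.W s' * (D.W s)⁻¹) : 𝔤.Elem).series = (D.serR b s' s).series :=
    fun s' => D.represents_R b s' s
  simp only [← h]
  rfl

/-- The degree of W(s + jv)W(s)⁻¹ grows at most like j, and the weight j - r of the coefficient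
compensates exactly, so the bound r is uniform in j. -/
theorem degreeLE_smul_serR (hv : ∀ a, v.1 a ≤ 1) (hc : ∀ n j, c n j ∈ fil (A := TimeRing N) (j - r))
    (hc' : ∀ n j, j < 0 → c n j = 0) (b : Bool) (j : ℤ) :
    DegreeLE r fun l n => c n j • (D.serR b (s + j • v) s).series l n := by
  intro l n
  dsimp only
  rcases lt_or_ge j 0 with hj | hj
  · rw [hc' n j hj, zero_smul]
    exact Submodule.zero_mem _
  · have h : DegreeLE j (D.serR b (s + j • v) s).series := by
      refine D.degreeLE_serR b fun a => ?_
      change s.1 a + j • v.1 a - s.1 a ≤ j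
      rw [smul_eq_mul]
      nlinarith [hv a]
    have := Mat.smul_mem_fil (hc n j) (h l n)
    rwa [show j - r + (l - j) = l - r by ring] at this

/-- The operator `∑_j c_j W(s + j v) W(s)⁻¹` as a series of bounded degree. -/
def serShiftOp (hv : ∀ a, v.1 a ≤ 1) (hc : ∀ n j, c n j ∈ fil (A := TimeRing N) (j - r))
    (hc' : ∀ n j, j < 0 → c n j = 0) (b : Bool) : SideSeries N b :=
  .mk (rev b (D.shiftOp v s c)) (d := r) (by
    rw [rev_shiftOp]
    exact fun l n => tsum_mem_fil fun j => degreeLE_smul_serR hv hc hc' b j l n)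

theorem wsummable_coeff (hc : ∀ n j, c n j ∈ fil (A := TimeRing N) (j - r))
    (hc' : ∀ n j, j < 0 → c n j = 0) (n : ℤ) (x : ℤ → Mat N) :
    WSummable fun j => c n j • x j := by
  refine wsummable_of_Icc fun w => ⟨0, w + r, fun j hj => ?_⟩
  rcases hj with hj | hj
  · rw [hc' n j hj, zero_smul]
    exact Submodule.zero_mem _
  · have := Mat.smul_mem_fil (hc n j) (mem_fil_of_nonpos le_rfl (x j))
    exact mem_fil_of_le (by omega) this

theorem serShiftOp_mul_apply (hv : ∀ a, v.1 a ≤ 1)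
    (hc : ∀ n j, c n j ∈ fil (A := TimeRing N) (j - r))
    (hc' : ∀ n j, j < 0 → c n j = 0) (b : Bool) (Y : SideSeries N b) (l n : ℤ) (i₀ k₀ : Fin N) :
    (serShiftOp (D := D) (s := s) hv hc hc' b * Y).series l n i₀ k₀ =
      ∑' j : ℤ, c n j * (D.serR b (s + j • v) s * Y).series l n i₀ k₀ := by
  obtain ⟨e, he⟩ := Y.exists_degreeLE
  rw [BoundedSeries.series_mul, serShiftOp, BoundedSeries.series_mk, rev_shiftOp]
  have h := tsum_mul_series (sideSign b)
    (fun j l n => c n j • (D.serR b (s + j • v) s).series l n)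
    (degreeLE_smul_serR hv hc hc' b) (fun l n => wsummable_coeff hc hc' n _) he l n
  have h' : ∀ j, mul (sideSign b) (fun l n => c n j • (D.serR b (s + j • v) s).series l n)
      Y.series l n = c n j • (D.serR b (s + j • v) s * Y).series l n := by
    intro j
    have hw := (D.serR b (s + j • v) s).wsummable_mul Y l n
    rw [BoundedSeries.series_mul, mul, mul, Algebra.smul_def, ← hw.summable.tsum_mul_left]
    simp only [Algebra.smul_def, mul_assoc]
  simp only [h'] at h
  refine (congrFun (congrFun h i₀) k₀).trans ?_
  exact Mat.tsum_apply (wsummable_coeff hc hc' n _).summable i₀ k₀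

end Compare

theorem series_mul_of_lower {N : ℕ} {v : ℤ} (X Y : BoundedSeries (Mat N) v) {d : ℤ}
    (hX : ∀ j, d < j → ∀ n, X.series j n = 0) (hY : ∀ j, 0 < j → ∀ n, Y.series j n = 0) (j : ℤ)
    (hj : d < j) (n : ℤ) : (X * Y).series j n = 0 := by
  rw [BoundedSeries.series_mul]
  refine (tsum_congr fun i => ?_).trans tsum_zero
  rcases lt_or_ge d i with hi | hi
  · rw [hX i hi, zero_mul]
  · rw [hY (j - i) (by omega), mul_zero]

/-! ### Vanishing of the comparison operator and the wave equations -/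

section Main

variable {N : ℕ} [NeZero N] {𝔤 : LaurentAlgebra N} {D : Factorization 𝔤}
  {v : Idx N → Charge N}
  {pr : Idx N → ShiftSeries (Charge N) (TimeRing N) → ShiftSeries (Charge N) (TimeRing N)}

theorem exists_sideIdx (a : Idx N) : ∃ b k, a = sideIdx b k := by
  rcases a with k | k
  · exact ⟨true, k, rfl⟩
  · exact ⟨false, k, rfl⟩

theorem actTerm_Ψ (X : ShiftSeries (Charge N) (TimeRing N)) {v : Charge N} (b : Bool) (k : Fin N)
    (hv : v.1 (sideIdx b k) = 1) (n m : ℤ) (s : Charge N) :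
    actTerm v X (D.Ψ (sideIdx b k) n) s m = fun j => X j s * D.scalarW v (sideIdx b k) n
      (sideSign b * (m - n) + ν (sideIdx b k) - s.1 (sideIdx b k) - j) (s + j • v) := by
  funext j
  rw [actTerm, Ψ_eq_scalarW _ _ _ _ v]
  congr 2
  change _ - (s.1 (sideIdx b k) + j • v.1 (sideIdx b k)) = _
  rw [hv, smul_eq_mul, mul_one]
  ring

theorem exists_degreeLE_scalarF (hD : D.Nondegenerate) (v : Idx N → Charge N)
    {F : Idx N → ℕ → ℤ → ℂ} (hF : ∀ a, Admissible (F a)) (a : Idx N) :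
    ∃ r, 0 ≤ r ∧ ∀ n, DegreeLE r (D.scalarF (v a) F a n) := by
  obtain ⟨r, hr⟩ := (hF a).1
  exact ⟨max r 0, le_max_right _ _, fun n =>
    (degreeLE_scalarF hD (v a) n hr).mono (le_max_left _ _)⟩

theorem IsProjection.waveEquations (hp : IsProjection v pr) (hD : D.Nondegenerate)
    {F : Idx N → ℕ → ℤ → ℂ} (hF : ∀ a, Admissible (F a)) {s : Charge N}
    (hstring : D.StringEquation s F) : D.WaveEquations v pr F s := by
  choose r hr hdeg using exists_degreeLE_scalarF hD v hF
  have hv : ∀ a a', (v a').1 a ≤ 1 := by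
    intro a a'
    by_cases h : a = a'
    · rw [h, hp.self]
    · exact (hp.nonpos a a' h).trans zero_le_one
  let c : Idx N → ℤ → ℤ → TimeRing N := fun a' n j => pr a' (D.scalarF (v a') F a' n) j s
  have hc : ∀ a' n j, c a' n j ∈ fil (A := TimeRing N) (j - r a') := fun a' n j =>
    hp.mem_fil (hr a') (hdeg a' n) a' j s
  have hc' : ∀ a' n j, j < 0 → c a' n j = 0 := fun a' n j hj => hp.of_neg _ _ _ _ hj
  let P : ∀ b, Idx N → SideSeries N b := fun b a' =>
    serShiftOp (D := D) (s := s) (fun a => hv a a') (hc a') (hc' a') b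
  let Z : ∀ b, SideSeries N b := fun b => D.serSum b s hF - ∑ a', P b a'
  let Q : ∀ b, SideSeries N b := fun b => BoundedSeries.single (sideSign b) 0 0 * Z b
  -- the row operator is the same on both sides
  let Q₀ : MatSeries N := mul 1 (EΛ 0 0) (D.sideSum true s F) -
    ∑ a', mul 1 (EΛ 0 0) (D.shiftOp (v a') s (c a'))
  have hQ₀ : ∀ b, rev b Q₀ = (Q b).series := by
    intro b
    -- The string equation enters only here.
    have h1 : mul 1 (EΛ 0 0) (D.sideSum true s F) = mul 1 (EΛ 0 0) (D.sideSum b s F) := by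
      cases b
      · exact hstring
      · rfl
    have hE : rev b (EΛ 0 0 : MatSeries N) = (BoundedSeries.single (sideSign b) 0 0).series := by
      have := rev_monomial b 0 fun _ => (Matrix.single 0 0 1 : Mat N)
      rwa [mul_zero] at this
    simp only [Q₀, Q, Z]
    rw [h1, mul_sub, Finset.mul_sum, BoundedSeries.series_sub, BoundedSeries.series_mul,
      ← D.rev_sideSum b s hF, ← hE, mul_rev, BoundedSeries.series_sum]
    have h2 : ∀ a', (BoundedSeries.single (sideSign b) 0 0 * P b a').series =
        rev b (mul 1 (EΛ 0 0) (D.shiftOp (v a') s (c a'))) := by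
      intro a'
      rw [BoundedSeries.series_mul, ← hE, ← mul_rev]
      rfl
    simp only [h2, ← rev_sum]
    rfl
  have hrow : ∀ b (Y : SideSeries N b) l n i k, (Q b * Y).series l n i k =
      if i = 0 then (Z b * Y).series l n 0 k else 0 := by
    intro b Y l n i k
    simp only [Q]
    rw [mul_assoc, BoundedSeries.series_mul, BoundedSeries.series_single, EΛ, monomial_mul,
      sub_zero, zero_smul, add_zero]
    split_ifs with hi
    · subst hi; simp
    · rw [Matrix.single_mul_apply_of_ne _ _ _ _ _ hi]
  have hZ : ∀ b (Y : SideSeries N b) l n k, (Z b * Y).series l n 0 k =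
      (D.serSum b s hF * Y).series l n 0 k -
        ∑ a', ∑' j : ℤ, c a' n j * (D.serR b (s + j • v a') s * Y).series l n 0 k := by
    intro b Y l n k
    simp only [Z]
    rw [sub_mul, Finset.sum_mul, BoundedSeries.series_sub, BoundedSeries.series_sum]
    simp only [Pi.sub_apply, Finset.sum_apply, Matrix.sub_apply, Matrix.sum_apply]
    congr 1
    exact Finset.sum_congr rfl fun a' _ => serShiftOp_mul_apply _ _ _ b Y l n 0 k
  -- After multiplication by S or S̄, the index a' = a reproduces F_a K_a and every other index
  -- contributes zero in these powers.
  have hvanish : ∀ b k l n, (0 < l ∨ l = 0 ∧ sideIdx b k = Sum.inl 0) →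
      (Z b * D.serS b s).series (l - ν (sideIdx b k)) n 0 k = 0 := by
    intro b k l n hl
    rw [hZ, serSum_mul_serS_eq b s k n hD hF (hp.self _),
      Finset.sum_eq_single (sideIdx b k), sub_eq_zero,
      ← hp.tsum_mul_K_self D (sideIdx b k) n hl s]
    · refine tsum_congr fun j => ?_
      rw [D.serR_mul_serS_eq]
      congr 2
      change _ = l - (s.1 _ + j • (v _).1 _ - s.1 _)
      rw [smul_eq_mul]
      ring
    · intro a' _ ha'
      rw [← hp.tsum_mul_K_of_ne (hr a') (hdeg a' n) D ha'.symm n hl s]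
      refine tsum_congr fun j => ?_
      rw [D.serR_mul_serS_eq]
      congr 2
      change l - (s.1 _ + j • (v _).1 _ - s.1 _) = _
      rw [smul_eq_mul]
      ring
    · simp
  have hQS : ∀ b (d : ℤ), (∀ (k : Fin N) l, d < l → 0 < l + ν (sideIdx b k) ∨
      l + ν (sideIdx b k) = 0 ∧ sideIdx b k = Sum.inl 0) →
      ∀ l, d < l → ∀ n, (Q b).series l n = 0 := by
    intro b d hd l hl n
    -- The inverse of S or S̄ has no positive powers in the variable of its side, so multiplying by
    -- it preserves the upper bound just found for the product.
    rw [show Q b = Q b * D.serS b s * (↑(D.serS b s)⁻¹ : SideSeries N b) by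
      rw [Units.mul_inv_cancel_right]]
    refine series_mul_of_lower (Q b * (D.serS b s : SideSeries N b))
      (↑(D.serS b s)⁻¹ : SideSeries N b) (fun j hj n => ?_)
      (fun j hj n => D.rev_sideS_inv_of_pos b s hj n) l hl n
    ext i k : 2
    rw [hrow]
    split_ifs with hi
    · have := hvanish b k (j + ν (sideIdx b k)) n (hd k j hj)
      rw [add_sub_cancel_right] at this
      rw [this, hi]
      rfl
    · rfl
  -- The barred side removes the negative powers of Λ, the unbarred side all l ≥ 0.
  have hzero : Q₀ = 0 := by
    funext l n
    rcases lt_or_ge l 0 with hl | hl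
    · have := hQS false 0 (fun k l hl => Or.inl (by simpa [ν, sideIdx] using hl)) (-l)
        (by omega) n
      rw [← hQ₀] at this
      simpa [rev, sideSign] using this
    -- The bound -1 includes l = 0: for k = 1 this is the extra case of `hvanish`, for k ≠ 1 the
    -- offset ν = 1 makes l + ν positive.
    · have := hQS true (-1) (fun k l hl => by
        by_cases hk : k = 0
        · subst hk
          simp [ν, sideIdx]
          omega
        · left
          simp [ν, sideIdx, hk]
          omega) l (by omega) n
      rw [← hQ₀] at this
      simpa [rev, sideSign] using this
  have hQ : ∀ b, Q b = 0 := by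
    intro b
    ext1
    rw [← hQ₀ b, hzero]
    rfl
  intro a n m
  obtain ⟨b, k, rfl⟩ := exists_sideIdx a
  have hsum : ∀ a', actTerm (v a') (pr a' (D.scalarF (v a') F a' n)) (D.Ψ (sideIdx b k) n) s m =
      fun j => c a' n j * (D.serR b (s + j • v a') s * D.serW b s).series
        (sideSign b * (m - n)) n 0 k := by
    intro a'
    funext j
    rw [serR_mul_serW, ← Ψ_sideIdx]
    rfl
  refine ⟨fun l s' => (wsummable_scalarF hD _ _ n hF l s').summable, ?_, fun a' => ?_, ?_⟩
  · rw [actTerm_Ψ _ b k (hp.self _)]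
    exact ((hdeg (sideIdx b k) n).wsummable_mul (degreeLE_scalarW _ _ n) _ s _).summable
  · exact ((hp.wsummable (hr a') (hdeg a' n) a' s).mul_right _).summable
  -- Multiplying Q = 0 by W or W̄ turns each quotient W(s')W(s)⁻¹ into W(s'), whose first row gives
  -- the wave functions at s'.
  · have h := hrow b (D.serW b s) (sideSign b * (m - n)) n 0 k
    rw [hQ, zero_mul, if_pos rfl, hZ] at h
    have h2 := serSum_mul_serW_eq b s k n hD hF (hp.self _)
      (sideSign b * (m - n) + ν (sideIdx b k) - s.1 (sideIdx b k))
    have h3 := sub_eq_zero.1 h.symm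
    calc act (v (sideIdx b k)) (D.scalarF (v (sideIdx b k)) F (sideIdx b k) n)
          (D.Ψ (sideIdx b k) n) s m
        = mul (v (sideIdx b k)) (D.scalarF (v (sideIdx b k)) F (sideIdx b k) n)
            (D.scalarW (v (sideIdx b k)) (sideIdx b k) n)
            (sideSign b * (m - n) + ν (sideIdx b k) - s.1 (sideIdx b k)) s := by
          rw [act, actTerm_Ψ _ b k (hp.self _)]
          rfl
      _ = (D.serSum b s hF * D.serW b s).series (sideSign b * (m - n)) n 0 k := by
          rw [← h2]
          exact entry_congr n (by ring) 0 k
      _ = _ := by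
          rw [h3]
          refine Finset.sum_congr rfl fun a' _ => ?_
          rw [act, hsum]

end Main

end Factorization

end Toda

end

theorem mainTheorem4 {N : ℕ} [NeZero N] (𝔤 : Toda.LaurentAlgebra N)
    (D : Toda.Factorization 𝔤) (hD : D.Nondegenerate)
    (a₀ b₀ : Toda.Idx N) (ha₀ : a₀ ≠ Sum.inl 0) (hb₀ : b₀ ≠ Sum.inr 0)
    (F : Toda.Idx N → ℕ → ℤ → ℂ) (hF : ∀ a, Toda.Admissible (F a))
    (s : Toda.Charge N) (hstring : D.StringEquation s F) :
    D.WaveEquations (Toda.Factorization.dir a₀) Toda.Factorization.plus F s ∧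
    D.WaveEquations (Toda.Factorization.dirBar b₀) (Toda.Factorization.plusBar b₀) F s :=
  ⟨(Toda.Factorization.isProjection_dir ha₀).waveEquations hD hF hstring,
    (Toda.Factorization.isProjection_dirBar hb₀).waveEquations hD hF hstring⟩
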